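/- **Setting.** Let $D\subset\mathbb R^d$ be finite, $f:\mathbb R^d\to\mathbb R$ with a unique maximiser $x^*$ on $D$, and let $k$ be a kernel that is positive semidefinite on $D$ and separates its points: $k(x,x)+k(x',x')-2k(x,x')>0$ for distinct $x,x'\in D$. Let $\lambda,\gamma>0$ and $\delta\in(0,1)$. In round $t=1,2,\dots$ a point $\tilde x_t\in D$ is queried and $y_t=f(\tilde x_t)+\epsilon_t$ is observed, where the $\epsilon_t$ are i.i.d. $\mathcal N(0,\lambda)$ and $\epsilon_t$ is independent of the information available when $\tilde x_t$ is chosen. Let $X_t=(\tilde x_1,\dots,\tilde x_t)$, $\mathbf y_t=(y_1,\dots,y_t)$, and let $$\mu_{f_t}(x)=k(x,X_t)(k(X_t,X_t)+\lambda I)^{-1}\mathbf y_t,\qquad \sigma_{f_t}^2(x)=k(x,x)-k(x,X_t)(k(X_t,X_t)+\lambda I)^{-1}k(X_t,x)$$ be the Gaussian-process posterior mean and variance. The user belief after $t$ rounds is an arbitrary (possibly random, history-dependent or adversarial) family of Gaussians $\mathcal N(m_t(x),v_t(x))$, $x\in D$, whose means are bounded in $t$ and $x$ (for each outcome). With $\rho_t(z)=\bar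 y_t z+s_t$, where $\bar y_t$ and $s_t^2$ are the empirical mean and variance of $\mathbf y_t$, put $$\mu_{\hat\pi_t}=\rho_t(m_t),\quad \sigma^2_{\hat\pi_t}=\rho_t(v_t)^2+\gamma t^2\sigma^2_{f_t},\quad \sigma^2_{f_t,\hat\pi_t}=\frac{\sigma^2_{\hat\pi_t}\sigma^2_{f_t}}{\sigma^2_{\hat\pi_t}+\sigma^2_{f_t}},\quad \mu_{f_t,\hat\pi_t}=\frac{\sigma^2_{f_t,\hat\pi_t}}{\sigma^2_{\hat\pi_t}}\mu_{\hat\pi_t}+\frac{\sigma^2_{f_t,\hat\pi_t}}{\sigma^2_{f_t}}\mu_{f_t}$$ (with the convention $z/0=0$). Let $\beta_t=2\log(|D|p_t/\delta)$ with $p_t>0$, $\sum_{t\ge1}p_t^{-1}=1$ and $\log p_t=O(\log t)$, and $$\alpha_{f_{t-1}}=\mu_{f_{t-1}}+\beta_t^{1/2}\sigma_{f_{t-1}},\qquad \alpha_{f_{t-1},\hat\pi_{t-1}}=\mu_{f_{t-1},\hat\pi_{t-1}}+\beta_t^{1/2}\sigma_{f_{t-1},\hat\pi_{t-1}}.$$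 In round $t$ the candidates are maximisers $x_{1,t}\in\arg\max_D\alpha_{f_{t-1}}$ (standard UCB) and $x_{2,t}\in\arg\max_D\alpha_{f_{t-1},\hat\pi_{t-1}}$, and the user queries $\tilde x_t\in\{x_{1,t},x_{2,t}\}$, in any way that does not look at $\epsilon_t,\epsilon_{t+1},\dots$ Let $r_t=f(x^*)-f(x_{1,t})$ and $r^\pi_t=f(x^*)-f(x_{2,t})$, and let $\gamma_T=\max_{X\in D^T}\tfrac12\log\det(I+\lambda^{-1}k(X,X))$ be the maximum information gain. **Claim (no harm guarantee).** Almost surely, on the event that $|f(x)-\mu_{f_{t-1}}(x)|\le\beta_t^{1/2}\sigma_{f_{t-1}}(x)$ for all $x\in D$ and $t\ge1$, the following hold. 1. As $t\to\infty$, for every $x\in D$, $\sigma^2_{f_t,\hat\pi_t}(x)-\sigma^2_{f_t}(x)\to0$, $\mu_{f_t,\hat\pi_t}(x)-\mu_{f_t}(x)\to0$ and $\alpha_{f_t,\hat\pi_t}(x)-\alpha_{f_t}(x)\to0$. 2. $\|x_{2,t}-x_{1,t}\|\to0$. 3. The regrets are asymptotically equal: $r^\pi_t=(1+o(1))\,r_t$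 as $t\to\infty$; in particular $r^\pi_t/r_t\to1$ along the rounds with $r_t\neq0$. 4. $\sum_{t\le T}r^\pi_t=O(\sqrt{T\gamma_T\log T})$ and $\sum_{t\le T}\bigl(f(x^*)-f(\tilde x_t)\bigr)=O(\sqrt{T\gamma_T\log T})$ as $T\to\infty$. -/

import Mathlib

open scoped Matrix NNReal MeasureTheory Asymptotics

noncomputable section

namespace CoExBO

/-! Gaussian process regression with kernel `k`, prior mean zero and likelihood variance `lam`,
from the observations `y i` made at the inputs `X i`. -/

section Posterior

variable {E : Type*} (k : E → E → ℝ) (lam : ℝ≥0) {n : ℕ} (X : Fin n → E) (y : Fin n → ℝ)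

/-- The kernel matrix `k(X, X)`. -/
def gram : Matrix (Fin n) (Fin n) ℝ :=
  Matrix.of fun i j => k (X i) (X j)

/-- The regularised inverse `(k(X, X) + lam I)⁻¹`. -/
def regInv : Matrix (Fin n) (Fin n) ℝ :=
  (gram k X + (lam : ℝ) • (1 : Matrix (Fin n) (Fin n) ℝ))⁻¹

/-- Posterior mean `k(x, X) (k(X, X) + lam I)⁻¹ y`. -/
def postMean (x : E) : ℝ :=
  (fun i => k x (X i)) ⬝ᵥ (regInv k lam X *ᵥ y)

/-- Posterior covariance `k(x, x') - k(x, X) (k(X, X) + lam I)⁻¹ k(X, x')`. -/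
def postCov (x x' : E) : ℝ :=
  k x x' - (fun i => k x (X i)) ⬝ᵥ (regInv k lam X *ᵥ fun i => k (X i) x')

/-- Posterior variance. -/
def postVar (x : E) : ℝ := postCov k lam X x x

/-- Upper confidence bound acquisition function with exploration parameter `b`. -/
def ucb (b : ℝ) (x : E) : ℝ :=
  postMean k lam X y x + √b * √(postVar k lam X x)

/-- Empirical mean of the observations. -/
def obsMean : ℝ := (∑ i, y i) / n

/-- Empirical variance of the observations. -/
def obsVar : ℝ := (∑ i, (y i - obsMean y) ^ 2) / n

/-- The scaling map `ρ(z) = E[y] z + √V[y]`. -/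
def scale (z : ℝ) : ℝ := obsMean y * z + √(obsVar y)

/-! The user belief at a point `x` is the Gaussian `N(m x, v x)`. The round number that enters
the decay term is the number `n` of observations made so far. -/

variable (gam : ℝ) (m : E → ℝ) (v : E → ℝ≥0)

/-- Mean of the scaled user belief. -/
def prefMean (x : E) : ℝ := scale y (m x)

/-- Variance of the scaled user belief, with the decay term `gam n² σ²(x)`. -/
def prefVar (x : E) : ℝ :=
  (scale y (v x)) ^ 2 + gam * (n : ℝ) ^ 2 * postVar k lam X x

/-- Variance of the preference-augmented posterior. -/
def augVar (x : E) : ℝ :=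
  prefVar k lam X y gam v x * postVar k lam X x /
    (prefVar k lam X y gam v x + postVar k lam X x)

/-- Mean of the preference-augmented posterior. -/
def augMean (x : E) : ℝ :=
  augVar k lam X y gam v x / prefVar k lam X y gam v x * prefMean y m x +
    augVar k lam X y gam v x / postVar k lam X x * postMean k lam X y x

/-- Preference-augmented acquisition function. -/
def augUcb (b : ℝ) (x : E) : ℝ :=
  augMean k lam X y gam m v x + √b * √(augVar k lam X y gam v x)

end Posterior

/-- The maximum information gain
`γ_T = max ½ log det (I + lam⁻¹ k(X, X))` over all choices of `T` query points in `D`,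
repetitions allowed. -/
def maxInfoGain {E : Type*} (k : E → E → ℝ) (lam : ℝ≥0) (D : Finset E) (T : ℕ) : ℝ :=
  ⨆ X : Fin T → D,
    (1 / 2) * Real.log
      (1 + ((lam : ℝ)⁻¹) • gram k (fun i => (X i : E)) : Matrix (Fin T) (Fin T) ℝ).det

/-- The exploration parameter `2 log(|D| p_t / δ)`; the round `t` is indexed by `n = t - 1`. -/
def beta {E : Type*} (D : Finset E) (p : ℕ → ℝ) (δ : ℝ) (n : ℕ) : ℝ :=
  2 * Real.log (D.card * p n / δ)

/-- The inputs queried in the first `n` rounds. -/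
def inputs {E Ω : Type*} (q : ℕ → Ω → E) (ω : Ω) (n : ℕ) : Fin n → E :=
  fun i => q i ω

/-- The noisy observations `y = f(q) + ε` of the first `n` rounds. -/
def outputs {E Ω : Type*} (f : E → ℝ) (q : ℕ → Ω → E) (ε : ℕ → Ω → ℝ) (ω : Ω) (n : ℕ) :
    Fin n → ℝ :=
  fun i => f (q i ω) + ε i ω

end CoExBO

end

/-! The candidates `x₁` and `x₂` almost surely coincide from some round on, and everything else
follows from this. The decay term makes the relative weight of the user belief in the augmented
posterior at most 1 / (gam n²). Observations are O(log n) and, on the confidence event, so are the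
posterior means. The augmented mean, variance and acquisition function therefore differ from the
standard ones by O(log n / n²) (`eventually_augmented_close`), and maximality of both candidates
puts their standard upper confidence bounds within (log n)² / n² of each other.

Such a near tie between distinct points x and x' cannot keep occurring at a visited x. In feature
coordinates the difference of the two bounds is a term fixed by the visit numbers plus a weighted
sum of the noise (`ucb_sub_eq`); let S be the sum of the squared weights (`weightSq`). If S <
n^(-3/2), the data hardly inform about the difference, so x' has a larger posterior variance than x
by a constant, while the posterior means are close; the bounds are then well apart
(`eventually_gap_of_weightSq_lt`). If S ≥ n^(-3/2), the noise term is spread over a scale of at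
least order n^(-3/4), and it lands in a window of width (log n)² / n² with probability O((log n)²
n^(-5/4)).

The queries depend on the noise, so conditioning on the visit numbers destroys Gaussianity. Instead
the weights are frozen at those of one visit vector N, and a supermartingale bounds the probability
that the visits equal N and the noise hits the window (`measure_weightedNoise_le`). A union bound
over N is affordable because suboptimal points are visited at most O(log n) times
(`visits_eventually_le_of_ucb_ge`), which leaves polylogarithmically many N. Borel–Cantelli
concludes (`eventually_not_near_tie`).

So, from some round on, distinct candidates force a query at an unvisited point, which can happen
only finitely often (`eventually_eq_of_ties`). The same visit bounds give cumulative regret O((log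
T)²), and the information gain is bounded below by a positive constant unless D is a single point.
-/

noncomputable section

namespace CoExBO

/-! ### Linear algebra of regularised least squares in feature space. -/

section Features

variable {ι κ : Type*} [Fintype ι] [Fintype κ] [DecidableEq κ]

/-- Regularised information matrix `lam I + ∑ N z φ z (φ z)ᵀ` when each feature `φ z` has been
observed `N z` times. -/
def infoMatrix (φ : ι → κ → ℝ) (lam : ℝ) (N : ι → ℕ) : Matrix κ κ ℝ :=
  lam • (1 : Matrix κ κ ℝ) + ∑ z, (N z : ℝ) • Matrix.vecMulVec (φ z) (φ z)

/-- The solution `A⁻¹ b` of the linear system of the information matrix `A`. -/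
def infoSolve (φ : ι → κ → ℝ) (lam : ℝ) (N : ι → ℕ) (b : κ → ℝ) : κ → ℝ :=
  (infoMatrix φ lam N)⁻¹ *ᵥ b

variable (φ : ι → κ → ℝ) {lam : ℝ} (N : ι → ℕ)

lemma infoMatrix_mulVec (v : κ → ℝ) :
    infoMatrix φ lam N *ᵥ v = lam • v + ∑ z, ((N z : ℝ) * (φ z ⬝ᵥ v)) • φ z := by
  have h (z : ι) : Matrix.vecMulVec (φ z) (φ z) *ᵥ v = (φ z ⬝ᵥ v) • φ z := by
    ext j
    simp only [Matrix.vecMulVec, Matrix.mulVec, dotProduct, Finset.sum_mul, Matrix.of_apply,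
      Pi.smul_apply, smul_eq_mul]
    exact Finset.sum_congr rfl fun _ _ => by ring
  rw [infoMatrix, Matrix.add_mulVec, Matrix.smul_mulVec, Matrix.one_mulVec, Matrix.sum_mulVec]
  congr 1
  refine Finset.sum_congr rfl fun z _ => ?_
  rw [Matrix.smul_mulVec, h, smul_smul]

lemma dotProduct_infoMatrix_mulVec (w v : κ → ℝ) :
    w ⬝ᵥ (infoMatrix φ lam N *ᵥ v) =
      lam * (w ⬝ᵥ v) + ∑ z, (N z : ℝ) * (φ z ⬝ᵥ v) * (φ z ⬝ᵥ w) := by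
  rw [infoMatrix_mulVec, dotProduct_add, dotProduct_smul, smul_eq_mul, dotProduct_sum]
  congr 1
  refine Finset.sum_congr rfl fun z _ => ?_
  rw [dotProduct_smul, smul_eq_mul, dotProduct_comm w]

lemma real_dotProduct_self_nonneg {κ : Type*} [Fintype κ] (v : κ → ℝ) : 0 ≤ v ⬝ᵥ v :=
  Finset.sum_nonneg fun _ _ => mul_self_nonneg _

lemma infoMatrix_isUnit (hlam : 0 < lam) : IsUnit (infoMatrix φ lam N) := by
  rw [← Matrix.mulVec_injective_iff_isUnit]
  refine (injective_iff_map_eq_zero (infoMatrix φ lam N).mulVecLin).2 fun v hv => ?_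
  have h := dotProduct_infoMatrix_mulVec (lam := lam) φ N v v
  rw [show infoMatrix φ lam N *ᵥ v = 0 from hv, dotProduct_zero] at h
  have h1 : 0 ≤ ∑ z, (N z : ℝ) * (φ z ⬝ᵥ v) * (φ z ⬝ᵥ v) :=
    Finset.sum_nonneg fun z _ => by
      rw [mul_assoc]; exact mul_nonneg (by positivity) (mul_self_nonneg _)
  have h2 := real_dotProduct_self_nonneg v
  have h3 : v ⬝ᵥ v = 0 := by nlinarith
  exact dotProduct_self_eq_zero.1 h3

lemma infoMatrix_mulVec_infoSolve (hlam : 0 < lam) (b : κ → ℝ) :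
    infoMatrix φ lam N *ᵥ infoSolve φ lam N b = b := by
  rw [infoSolve, Matrix.mulVec_mulVec, Matrix.mul_nonsing_inv _
    ((Matrix.isUnit_iff_isUnit_det _).1 (infoMatrix_isUnit φ N hlam)), Matrix.one_mulVec]

lemma infoSolve_eq_of_mulVec (hlam : 0 < lam) {b v : κ → ℝ} (h : infoMatrix φ lam N *ᵥ v = b) :
    infoSolve φ lam N b = v := by
  rw [infoSolve, ← h, Matrix.mulVec_mulVec, Matrix.nonsing_inv_mul _
    ((Matrix.isUnit_iff_isUnit_det _).1 (infoMatrix_isUnit φ N hlam)), Matrix.one_mulVec]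

lemma infoSolve_sub (b c : κ → ℝ) :
    infoSolve φ lam N (b - c) = infoSolve φ lam N b - infoSolve φ lam N c :=
  Matrix.mulVec_sub _ _ _

lemma dotProduct_eq_infoSolve (hlam : 0 < lam) (w b : κ → ℝ) :
    w ⬝ᵥ b = lam * (w ⬝ᵥ infoSolve φ lam N b) +
      ∑ z, (N z : ℝ) * (φ z ⬝ᵥ infoSolve φ lam N b) * (φ z ⬝ᵥ w) := by
  rw [← dotProduct_infoMatrix_mulVec, infoMatrix_mulVec_infoSolve φ N hlam]

lemma dotProduct_infoSolve_comm (hlam : 0 < lam) (b c : κ → ℝ) :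
    b ⬝ᵥ infoSolve φ lam N c = c ⬝ᵥ infoSolve φ lam N b := by
  rw [dotProduct_comm b, dotProduct_comm c,
    dotProduct_eq_infoSolve φ N hlam (infoSolve φ lam N c) b,
    dotProduct_eq_infoSolve φ N hlam (infoSolve φ lam N b) c,
    dotProduct_comm (infoSolve φ lam N c)]
  congr 1
  exact Finset.sum_congr rfl fun z _ => by ring

lemma infoSolve_quadratic (hlam : 0 < lam) (b : κ → ℝ) :
    b ⬝ᵥ infoSolve φ lam N b = lam * (infoSolve φ lam N b ⬝ᵥ infoSolve φ lam N b) +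
      ∑ z, (N z : ℝ) * (φ z ⬝ᵥ infoSolve φ lam N b) ^ 2 := by
  rw [dotProduct_comm, dotProduct_eq_infoSolve φ N hlam (infoSolve φ lam N b) b]
  simp only [mul_assoc, sq]

/-- Squared length of the vector of the weights `φ z ⬝ᵥ A⁻¹ b` over the observations. -/
def weightSq (φ : ι → κ → ℝ) (lam : ℝ) (N : ι → ℕ) (b : κ → ℝ) : ℝ :=
  ∑ z, (N z : ℝ) * (φ z ⬝ᵥ infoSolve φ lam N b) ^ 2

lemma weightSq_nonneg (b : κ → ℝ) : 0 ≤ weightSq φ lam N b :=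
  Finset.sum_nonneg fun _ _ => by positivity

lemma infoSolve_quadratic_nonneg (hlam : 0 < lam) (b : κ → ℝ) :
    0 ≤ b ⬝ᵥ infoSolve φ lam N b := by
  rw [infoSolve_quadratic φ N hlam]
  exact add_nonneg (mul_nonneg hlam.le (real_dotProduct_self_nonneg _)) (weightSq_nonneg φ N b)

lemma infoSolve_quadratic_eq_zero (hlam : 0 < lam) {b : κ → ℝ}
    (h : b ⬝ᵥ infoSolve φ lam N b = 0) : b = 0 := by
  have h1 := infoSolve_quadratic φ N hlam b
  have h2 : 0 ≤ ∑ z, (N z : ℝ) * (φ z ⬝ᵥ infoSolve φ lam N b) ^ 2 := weightSq_nonneg φ N b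
  have h3 := real_dotProduct_self_nonneg (infoSolve φ lam N b)
  have h4 : infoSolve φ lam N b ⬝ᵥ infoSolve φ lam N b = 0 := by nlinarith
  rw [← infoMatrix_mulVec_infoSolve φ N hlam b, dotProduct_self_eq_zero.1 h4, Matrix.mulVec_zero]

/-- With u = A⁻¹ b and b = lam u + s, the difference of the two sides is lam (u ⬝ᵥ s) + s ⬝ᵥ s, and
both terms are nonnegative. It says that data never increase the variance above its prior value. -/
lemma infoSolve_quadratic_le (hlam : 0 < lam) (b : κ → ℝ) :
    lam * (b ⬝ᵥ infoSolve φ lam N b) ≤ b ⬝ᵥ b := by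
  set u := infoSolve φ lam N b with hu
  have e : b = lam • u + ∑ z, ((N z : ℝ) * (φ z ⬝ᵥ u)) • φ z := by
    rw [← infoMatrix_mulVec, hu, infoMatrix_mulVec_infoSolve φ N hlam]
  set s := ∑ z, ((N z : ℝ) * (φ z ⬝ᵥ u)) • φ z with hs
  have h1 : 0 ≤ u ⬝ᵥ s := by
    rw [hs, dotProduct_sum]
    refine Finset.sum_nonneg fun z _ => ?_
    rw [dotProduct_smul, smul_eq_mul, dotProduct_comm u, mul_assoc]
    exact mul_nonneg (by positivity) (mul_self_nonneg _)
  have h2 := real_dotProduct_self_nonneg s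
  have h3 : b ⬝ᵥ b - lam * (b ⬝ᵥ u) = lam * (u ⬝ᵥ s) + s ⬝ᵥ s := by
    rw [e]
    simp only [dotProduct_add, add_dotProduct, smul_dotProduct, dotProduct_smul, smul_eq_mul,
      dotProduct_comm s u]
    ring
  nlinarith

lemma weight_sq_le (b : κ → ℝ) {z : ι} (hz : 0 < N z) :
    (φ z ⬝ᵥ infoSolve φ lam N b) ^ 2 ≤ weightSq φ lam N b := by
  have h1 : (N z : ℝ) * (φ z ⬝ᵥ infoSolve φ lam N b) ^ 2 ≤ weightSq φ lam N b :=
    Finset.single_le_sum (f := fun z => (N z : ℝ) * (φ z ⬝ᵥ infoSolve φ lam N b) ^ 2)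
      (fun _ _ => by positivity) (Finset.mem_univ z)
  have h2 : (1 : ℝ) ≤ N z := by exact_mod_cast hz
  nlinarith [sq_nonneg (φ z ⬝ᵥ infoSolve φ lam N b)]

/-- Writing t for the quadratic form, a single summand of `infoSolve_quadratic` gives N z * t² ≤ t.
This is the bound lam / N on the variance at a point visited N times. -/
lemma mul_infoSolve_quadratic_le_one (hlam : 0 < lam) (z : ι) :
    (N z : ℝ) * (φ z ⬝ᵥ infoSolve φ lam N (φ z)) ≤ 1 := by
  have h1 : (N z : ℝ) * (φ z ⬝ᵥ infoSolve φ lam N (φ z)) ^ 2 ≤ weightSq φ lam N (φ z) :=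
    Finset.single_le_sum (f := fun w => (N w : ℝ) * (φ w ⬝ᵥ infoSolve φ lam N (φ z)) ^ 2)
      (fun _ _ => by positivity) (Finset.mem_univ z)
  have h2 := infoSolve_quadratic φ N hlam (φ z)
  have h3 := real_dotProduct_self_nonneg (infoSolve φ lam N (φ z))
  have h4 := infoSolve_quadratic_nonneg φ N hlam (φ z)
  rw [weightSq] at h1
  set t := φ z ⬝ᵥ infoSolve φ lam N (φ z)
  rcases h4.eq_or_lt with h | h
  · rw [← h]; simp
  · have h5 : (N z : ℝ) * t ^ 2 ≤ t := by nlinarith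
    by_contra hc
    push Not at hc
    nlinarith

/-- Cauchy–Schwarz for the part of `b` that the observations explain. -/
lemma sq_sub_le_weightSq_mul (hlam : 0 < lam) (b : κ → ℝ) :
    (b ⬝ᵥ b - lam * (b ⬝ᵥ infoSolve φ lam N b)) ^ 2 ≤
      weightSq φ lam N b * ∑ z, (N z : ℝ) * (φ z ⬝ᵥ b) ^ 2 := by
  have h := dotProduct_eq_infoSolve φ N hlam b b
  have e : b ⬝ᵥ b - lam * (b ⬝ᵥ infoSolve φ lam N b) =
      ∑ z, (√(N z) * (φ z ⬝ᵥ infoSolve φ lam N b)) * (√(N z) * (φ z ⬝ᵥ b)) := by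
    rw [h, add_sub_cancel_left]
    refine Finset.sum_congr rfl fun z _ => ?_
    have := Real.mul_self_sqrt (Nat.cast_nonneg (α := ℝ) (N z))
    linear_combination (-(φ z ⬝ᵥ infoSolve φ lam N b) * (φ z ⬝ᵥ b)) * this
  rw [e, weightSq]
  refine (Finset.sum_mul_sq_le_sq_mul_sq _ _ _).trans_eq ?_
  congr 1 <;> refine Finset.sum_congr rfl fun z _ => ?_ <;>
    rw [mul_pow, Real.sq_sqrt (Nat.cast_nonneg _)]

/-- Used with the features of two points: the variance gap becomes the quadratic form of the
difference, up to the weight given to the first point, which is small when that point is visited and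
`weightSq` is small. -/
lemma infoSolve_quadratic_sub (hlam : 0 < lam) (b c : κ → ℝ) :
    c ⬝ᵥ infoSolve φ lam N c - b ⬝ᵥ infoSolve φ lam N b =
      (b - c) ⬝ᵥ infoSolve φ lam N (b - c) - 2 * (b ⬝ᵥ infoSolve φ lam N (b - c)) := by
  rw [infoSolve_sub]
  simp only [dotProduct_sub, sub_dotProduct]
  rw [dotProduct_infoSolve_comm φ N hlam c b]
  ring

end Features

/-! ### Posterior mean and variance in terms of visit numbers. -/

section Counts

variable {ι κ : Type*} [Fintype ι] [DecidableEq ι] [Fintype κ] [DecidableEq κ]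

/-- Number of occurrences of a value in a finite sequence. -/
def visits {n : ℕ} (Q : Fin n → ι) (z : ι) : ℕ := (Finset.univ.filter fun i => Q i = z).card

lemma sum_visits_mul {n : ℕ} (Q : Fin n → ι) (g : ι → ℝ) :
    ∑ z, (visits Q z : ℝ) * g z = ∑ i, g (Q i) := by
  rw [← Finset.sum_fiberwise (s := Finset.univ) (g := Q)]
  refine Finset.sum_congr rfl fun z _ => ?_
  rw [visits, ← nsmul_eq_mul, ← Finset.sum_const]
  refine Finset.sum_congr rfl fun i hi => ?_
  rw [(Finset.mem_filter.1 hi).2]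

variable {E : Type*} {D : Finset E} {k : E → E → ℝ} {φ : D → κ → ℝ}
  [DecidableEq D]

/-- Push-through identity Φᵀ (Φ Φᵀ + lam I)⁻¹ = (Φᵀ Φ + lam I)⁻¹ Φᵀ. It trades the growing kernel
matrix for one of fixed size that sees the queries only through their visit numbers. -/
lemma regInv_mulVec_feature (hφ : ∀ x y : D, k x y = φ x ⬝ᵥ φ y) {lam : ℝ≥0} (hlam : 0 < lam)
    {n : ℕ} (Q : Fin n → D) (y : Fin n → ℝ) :
    ∑ i, (regInv k lam (fun i => (Q i : E)) *ᵥ y) i • φ (Q i) =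
      infoSolve φ lam (visits Q) (∑ i, y i • φ (Q i)) := by
  have hl : (0 : ℝ) < lam := hlam
  set G := gram k (fun i => (Q i : E)) + (lam : ℝ) • (1 : Matrix (Fin n) (Fin n) ℝ) with hG
  have hGv (v : Fin n → ℝ) (i : Fin n) :
      (G *ᵥ v) i = φ (Q i) ⬝ᵥ (∑ j, v j • φ (Q j)) + lam * v i := by
    rw [hG, Matrix.add_mulVec, Matrix.smul_mulVec, Matrix.one_mulVec, Pi.add_apply,
      Pi.smul_apply, smul_eq_mul, dotProduct_sum]
    congr 1
    change ∑ j, k (Q i) (Q j) * v j = _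
    refine Finset.sum_congr rfl fun j _ => ?_
    rw [hφ, dotProduct_smul, smul_eq_mul, mul_comm]
  have hu : IsUnit G := by
    rw [← Matrix.mulVec_injective_iff_isUnit]
    refine (injective_iff_map_eq_zero G.mulVecLin).2 fun v hv => ?_
    have hv' : G *ᵥ v = 0 := hv
    have h0 : v ⬝ᵥ (G *ᵥ v) = (∑ j, v j • φ (Q j)) ⬝ᵥ (∑ j, v j • φ (Q j)) + lam * (v ⬝ᵥ v) := by
      rw [sum_dotProduct]
      simp only [smul_dotProduct, smul_eq_mul]
      change ∑ i, v i * (G *ᵥ v) i = _ + lam * ∑ i, v i * v i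
      simp only [hGv, mul_add, Finset.sum_add_distrib, Finset.mul_sum]
      congr 1
      exact Finset.sum_congr rfl fun _ _ => by ring
    rw [hv', dotProduct_zero] at h0
    have h1 := real_dotProduct_self_nonneg (∑ j, v j • φ (Q j))
    have h2 := real_dotProduct_self_nonneg v
    exact dotProduct_self_eq_zero.1 (by nlinarith)
  have hr : G *ᵥ (regInv k lam (fun i => (Q i : E)) *ᵥ y) = y := by
    rw [regInv, Matrix.mulVec_mulVec, Matrix.mul_nonsing_inv _
      ((Matrix.isUnit_iff_isUnit_det _).1 hu), Matrix.one_mulVec]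
  set r := regInv k lam (fun i => (Q i : E)) *ᵥ y
  refine (infoSolve_eq_of_mulVec φ _ hl ?_).symm
  rw [infoMatrix_mulVec]
  ext c
  simp only [Pi.add_apply, Pi.smul_apply, Finset.sum_apply, smul_eq_mul, mul_assoc]
  rw [sum_visits_mul Q (fun z => (φ z ⬝ᵥ ∑ j, r j • φ (Q j)) * φ z c), Finset.mul_sum,
    ← Finset.sum_add_distrib]
  refine Finset.sum_congr rfl fun i _ => ?_
  have := hGv r i
  rw [hr] at this
  rw [this]
  ring

lemma postMean_eq (hφ : ∀ x y : D, k x y = φ x ⬝ᵥ φ y) {lam : ℝ≥0} (hlam : 0 < lam)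
    {n : ℕ} (Q : Fin n → D) (y : Fin n → ℝ) (x : D) :
    postMean k lam (fun i => (Q i : E)) y x =
      ∑ i, (φ (Q i) ⬝ᵥ infoSolve φ lam (visits Q) (φ x)) * y i := by
  have h : postMean k lam (fun i => (Q i : E)) y x =
      φ x ⬝ᵥ ∑ i, (regInv k lam (fun i => (Q i : E)) *ᵥ y) i • φ (Q i) := by
    rw [postMean, dotProduct_sum]
    change ∑ i, k x (Q i) * _ = _
    refine Finset.sum_congr rfl fun i _ => ?_
    rw [dotProduct_smul, hφ, smul_eq_mul, mul_comm]
  rw [h, regInv_mulVec_feature hφ hlam, dotProduct_infoSolve_comm φ _ (by exact_mod_cast hlam),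
    sum_dotProduct]
  refine Finset.sum_congr rfl fun i _ => ?_
  rw [smul_dotProduct, smul_eq_mul, mul_comm]

/-- The subtracted term is a posterior mean for the data k(X, x). Splitting φ x ⬝ᵥ φ x by
`dotProduct_eq_infoSolve` cancels it and leaves the ridge part. -/
lemma postVar_eq (hφ : ∀ x y : D, k x y = φ x ⬝ᵥ φ y) {lam : ℝ≥0} (hlam : 0 < lam)
    {n : ℕ} (Q : Fin n → D) (x : D) :
    postVar k lam (fun i => (Q i : E)) x =
      lam * (φ x ⬝ᵥ infoSolve φ lam (visits Q) (φ x)) := by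
  have hl : (0 : ℝ) < lam := hlam
  have h := postMean_eq hφ hlam Q (fun i => k (Q i) x) x
  rw [postVar, postCov]
  rw [postMean] at h
  rw [h, hφ, dotProduct_eq_infoSolve φ (visits Q) hl (φ x) (φ x)]
  simp only [mul_assoc]
  rw [sum_visits_mul Q (fun z => (φ z ⬝ᵥ infoSolve φ lam (visits Q) (φ x)) * (φ z ⬝ᵥ φ x))]
  simp only [hφ, add_sub_cancel_right]

end Counts

set_option linter.unusedSectionVars false

/-! ### Visit numbers along the run. -/

section Visits

variable {ι Ω : Type*} [DecidableEq ι]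

/-- Number of visits to each point in the first `n` rounds. -/
def visitsTo (Q : ℕ → Ω → ι) (ω : Ω) (n : ℕ) : ι → ℕ := visits fun i : Fin n => Q i ω

lemma visitsTo_zero (Q : ℕ → Ω → ι) (ω : Ω) : visitsTo Q ω 0 = 0 := by
  ext z; simp [visitsTo, visits]

lemma visitsTo_succ (Q : ℕ → Ω → ι) (ω : Ω) (n : ℕ) :
    visitsTo Q ω (n + 1) = visitsTo Q ω n + Pi.single (Q n ω) 1 := by
  ext z
  simp only [visitsTo, visits, Finset.card_filter, Fin.sum_univ_castSucc, Pi.add_apply]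
  simp [Pi.single_apply, eq_comm]

lemma sum_visitsTo [Fintype ι] (Q : ℕ → Ω → ι) (ω : Ω) (n : ℕ) :
    ∑ z, visitsTo Q ω n z = n := by
  induction n with
  | zero => simp [visitsTo_zero]
  | succ n ih => simp [visitsTo_succ, Finset.sum_add_distrib, ih]

end Visits

/-! ### Anti-concentration and growth of the noise under adaptive sampling. -/

section AntiConcentration

open MeasureTheory ProbabilityTheory

/-- Gaussian convolution: averaging over one noise term returns its variance to the remaining
variance. This is the one-step martingale identity behind `hitProb`. -/
lemma lintegral_gaussianReal_shift (s a : ℝ) (r lam : ℝ≥0) {B : Set ℝ} (hB : MeasurableSet B) :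
    ∫⁻ e, gaussianReal (s + a * e) r B ∂(gaussianReal 0 lam) =
      gaussianReal s (NNReal.mk (a ^ 2) (sq_nonneg a) * lam + r) B := by
  have h1 : gaussianReal s (NNReal.mk (a ^ 2) (sq_nonneg a) * lam + r) =
      ((gaussianReal 0 lam).map (fun x => a * x)).conv (gaussianReal s r) := by
    rw [gaussianReal_map_const_mul, gaussianReal_conv_gaussianReal, mul_zero, zero_add]
  rw [h1, ← lintegral_indicator_one hB, Measure.lintegral_conv (measurable_one.indicator hB)]
  have h2 (x : ℝ) : ∫⁻ y, B.indicator 1 (x + y) ∂(gaussianReal s r) = gaussianReal (s + x) r B := by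
    rw [← gaussianReal_map_add_const, ← lintegral_indicator_one hB,
      lintegral_map (measurable_one.indicator hB) (by fun_prop)]
    simp only [add_comm x]
  simp only [h2]
  rw [lintegral_map _ (by fun_prop)]
  have : Measurable fun x : ℝ => (s + x, r) := by fun_prop
  exact (Measure.measurable_coe hB).comp (measurable_gaussianReal.comp this)

lemma gaussianReal_apply_le (μ : ℝ) {v : ℝ≥0} (hv : v ≠ 0) (a W : ℝ) :
    gaussianReal μ v {x | |a + x| ≤ W} ≤ ENNReal.ofReal (2 * W / √(2 * Real.pi * v)) := by
  have hB : {x : ℝ | |a + x| ≤ W} = Set.Icc (-W - a) (W - a) := by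
    ext x
    simp only [Set.mem_ofPred_eq, abs_le, Set.mem_Icc]
    constructor <;> rintro ⟨h1, h2⟩ <;> constructor <;> linarith
  rw [hB, gaussianReal_apply _ hv]
  have h (x : ℝ) : gaussianPDF μ v x ≤ ENNReal.ofReal (√(2 * Real.pi * v))⁻¹ := by
    refine ENNReal.ofReal_le_ofReal ?_
    rw [gaussianPDFReal]
    refine mul_le_of_le_one_right (by positivity) (Real.exp_le_one_iff.2 ?_)
    exact div_nonpos_of_nonpos_of_nonneg (by nlinarith [sq_nonneg (x - μ)]) (by positivity)
  refine (lintegral_mono h).trans_eq ?_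
  rw [setLIntegral_const, Real.volume_Icc, ← ENNReal.ofReal_mul (by positivity)]
  congr 1
  rw [div_eq_inv_mul]
  ring

variable {Ω ι : Type*} {mΩ : MeasurableSpace Ω} {P : Measure Ω} [IsProbabilityMeasure P]
  [Fintype ι] [DecidableEq ι] [MeasurableSpace ι] [MeasurableSingletonClass ι]
  {ℱ : Filtration ℕ mΩ} {ε : ℕ → Ω → ℝ} {lam : ℝ≥0} {Q : ℕ → Ω → ι}

/-- Variance still to be collected when `M z` of the `N z` observations with weight `c z` have
been made. -/
def remainingVar (lam : ℝ≥0) (c : ι → ℝ) (N M : ι → ℕ) : ℝ≥0 :=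
  lam * ∑ z, ((N z - M z : ℕ) : ℝ≥0) * NNReal.mk (c z ^ 2) (sq_nonneg (c z))

lemma remainingVar_add_single (lam : ℝ≥0) (c : ι → ℝ) {N M : ι → ℕ} {z : ι}
    (h : M + Pi.single z 1 ≤ N) :
    NNReal.mk (c z ^ 2) (sq_nonneg (c z)) * lam + remainingVar lam c N (M + Pi.single z 1) =
      remainingVar lam c N M := by
  have hz := h z
  simp only [Pi.add_apply, Pi.single_eq_same] at hz
  rw [remainingVar, remainingVar, ← Finset.add_sum_erase _ _ (Finset.mem_univ z),
    ← Finset.add_sum_erase (a := z) _ (fun w => ((N w - M w : ℕ) : ℝ≥0) * _) (Finset.mem_univ z)]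
  have h1 : N z - M z = (N z - (M z + 1)) + 1 := by omega
  have h2 : ∑ w ∈ Finset.univ.erase z, ((N w - (M + Pi.single z 1 : ι → ℕ) w : ℕ) : ℝ≥0) *
      NNReal.mk (c w ^ 2) (sq_nonneg (c w)) = ∑ w ∈ Finset.univ.erase z,
      ((N w - M w : ℕ) : ℝ≥0) * NNReal.mk (c w ^ 2) (sq_nonneg (c w)) := by
    refine Finset.sum_congr rfl fun w hw => ?_
    rw [Pi.add_apply, Pi.single_eq_of_ne (Finset.ne_of_mem_erase hw), add_zero]
  rw [h2, Pi.add_apply, Pi.single_eq_same, h1]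
  push_cast
  ring

open Classical in
/-- Conditional probability that the weighted noise ends in `B` when it is `s` after `M`
observations and is continued up to `N` observations. -/
def hitProb (lam : ℝ≥0) (c : ι → ℝ) (N : ι → ℕ) (B : Set ℝ) (x : ℝ × (ι → ℕ)) : ENNReal :=
  if x.2 ≤ N then gaussianReal x.1 (remainingVar lam c N x.2) B else 0

lemma measurable_hitProb (lam : ℝ≥0) (c : ι → ℝ) (N : ι → ℕ) {B : Set ℝ} (hB : MeasurableSet B) :
    Measurable (hitProb lam c N B) := by
  refine measurable_from_prod_countable_left fun M => ?_
  unfold hitProb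
  by_cases h : M ≤ N
  · simp only [h, if_true]
    have : Measurable fun x : ℝ => (x, remainingVar lam c N M) := by fun_prop
    exact (Measure.measurable_coe hB).comp (measurable_gaussianReal.comp this)
  · simp only [h, if_false]
    exact measurable_const

/-- Equality holds while the next visit stays within N; a visit beyond N sends the value to zero,
hence a supermartingale step whichever point is chosen. -/
lemma lintegral_hitProb_le (c : ι → ℝ) (N M : ι → ℕ) {B : Set ℝ} (hB : MeasurableSet B) (s : ℝ)
    (z : ι) : ∫⁻ e, hitProb lam c N B (s + c z * e, M + Pi.single z 1) ∂(gaussianReal 0 lam) ≤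
      hitProb lam c N B (s, M) := by
  unfold hitProb
  by_cases h : M + Pi.single z 1 ≤ N
  · have h' : M ≤ N := le_trans (le_add_of_nonneg_right zero_le) h
    simp only [h, h', if_true]
    rw [lintegral_gaussianReal_shift _ _ _ _ hB, remainingVar_add_single lam c h]
  · simp [h]

/-- The noise collected in the first `n` rounds with weight `c z` at the point `z`. -/
def weightedNoise (Q : ℕ → Ω → ι) (ε : ℕ → Ω → ℝ) (c : ι → ℝ) (n : ℕ) (ω : Ω) : ℝ :=
  ∑ i ∈ Finset.range n, c (Q i ω) * ε i ω

lemma measurable_weightedNoise (hεm : ∀ n, Measurable[ℱ (n + 1)] (ε n))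
    (hQ : ∀ n, Measurable[ℱ n] (Q n)) (c : ι → ℝ) (n : ℕ) :
    Measurable[ℱ n] (weightedNoise Q ε c n) := by
  refine Finset.measurable_fun_sum _ fun i hi => ?_
  have hi' : i + 1 ≤ n := Finset.mem_range.1 hi
  refine Measurable.mul ?_ ((hεm i).mono (ℱ.mono hi') le_rfl)
  exact (measurable_of_countable c).comp ((hQ i).mono (ℱ.mono (by omega)) le_rfl)

lemma measurable_visitsTo (hQ : ∀ n, Measurable[ℱ n] (Q n)) (n : ℕ) :
    Measurable[ℱ n] fun ω => visitsTo Q ω n := by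
  induction n with
  | zero => simp only [visitsTo_zero]; exact measurable_const
  | succ n ih =>
    simp only [visitsTo_succ]
    have h1 : Measurable[ℱ (n + 1)] fun ω => visitsTo Q ω n :=
      ih.mono (ℱ.mono n.le_succ) le_rfl
    have h2 : Measurable[ℱ (n + 1)] fun ω => (Pi.single (Q n ω) 1 : ι → ℕ) :=
      (measurable_of_countable fun z : ι => (Pi.single z 1 : ι → ℕ)).comp
        ((hQ n).mono (ℱ.mono n.le_succ) le_rfl)
    exact h1.add h2

/-- Supermartingale bound by induction. The past together with the next query is independent of the
next noise term, so Fubini reduces each round to `lintegral_hitProb_le`. -/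
lemma lintegral_hitProb_le_gaussianReal (hεm : ∀ n, Measurable[ℱ (n + 1)] (ε n))
    (hεlaw : ∀ n, P.map (ε n) = gaussianReal 0 lam)
    (hεind : ∀ n, Indep (MeasurableSpace.comap (ε n) inferInstance) (ℱ n) P)
    (hQ : ∀ n, Measurable[ℱ n] (Q n)) (c : ι → ℝ) (N : ι → ℕ) {B : Set ℝ}
    (hB : MeasurableSet B) (n : ℕ) :
    ∫⁻ ω, hitProb lam c N B (weightedNoise Q ε c n ω, visitsTo Q ω n) ∂P ≤
      gaussianReal 0 (remainingVar lam c N 0) B := by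
  induction n with
  | zero => simp [weightedNoise, visitsTo_zero, hitProb]
  | succ n ih =>
    refine le_trans ?_ ih
    let T : Ω → (ℝ × (ι → ℕ)) × ι := fun ω => ((weightedNoise Q ε c n ω, visitsTo Q ω n), Q n ω)
    have hT : Measurable[ℱ n] T :=
      ((measurable_weightedNoise hεm hQ c n).prodMk (measurable_visitsTo hQ n)).prodMk (hQ n)
    have hT' : Measurable T := hT.mono (ℱ.le n) le_rfl
    have hε' : Measurable (ε n) := (hεm n).mono (ℱ.le _) le_rfl
    have hind : IndepFun T (ε n) P := by
      rw [IndepFun_iff_Indep]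
      exact (indep_of_indep_of_le_right (hεind n) hT.comap_le).symm
    have hprod := (indepFun_iff_map_prod_eq_prod_map_map hT'.aemeasurable hε'.aemeasurable).1 hind
    let g : ((ℝ × (ι → ℕ)) × ι) × ℝ → ENNReal := fun x =>
      hitProb lam c N B (x.1.1.1 + c x.1.2 * x.2, x.1.1.2 + Pi.single x.1.2 1)
    have hg : Measurable g := by
      refine (measurable_hitProb lam c N hB).comp (Measurable.prodMk ?_ ?_)
      · have : Measurable c := measurable_of_countable c
        fun_prop
      · have : Measurable fun z : ι => (Pi.single z 1 : ι → ℕ) := measurable_of_countable _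
        fun_prop
    have e : ∫⁻ ω, hitProb lam c N B (weightedNoise Q ε c (n + 1) ω, visitsTo Q ω (n + 1)) ∂P =
        ∫⁻ ω, g (T ω, ε n ω) ∂P := by
      refine lintegral_congr fun ω => ?_
      simp only [g, T, weightedNoise, Finset.sum_range_succ, visitsTo_succ]
    rw [e, ← lintegral_map hg (hT'.prodMk hε'), hprod, lintegral_prod _ hg.aemeasurable, hεlaw,
      lintegral_map hg.lintegral_prod_right' hT']
    exact lintegral_mono fun ω => lintegral_hitProb_le c N _ hB _ _

/-- Anti-concentration of the weighted noise under adaptive sampling, on the event that the numbers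
of visits take a given value. -/
lemma measure_weightedNoise_le (hεm : ∀ n, Measurable[ℱ (n + 1)] (ε n))
    (hεlaw : ∀ n, P.map (ε n) = gaussianReal 0 lam)
    (hεind : ∀ n, Indep (MeasurableSpace.comap (ε n) inferInstance) (ℱ n) P)
    (hQ : ∀ n, Measurable[ℱ n] (Q n)) (hlam : 0 < lam) (c : ι → ℝ) (N : ι → ℕ)
    (hc : 0 < ∑ z, (N z : ℝ) * c z ^ 2) (a W : ℝ) (n : ℕ) :
    P {ω | visitsTo Q ω n = N ∧ |a + weightedNoise Q ε c n ω| ≤ W} ≤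
      ENNReal.ofReal (2 * W / √(2 * Real.pi * (lam * ∑ z, (N z : ℝ) * c z ^ 2))) := by
  have hB : MeasurableSet {x : ℝ | |a + x| ≤ W} := by measurability
  have hv : (remainingVar lam c N 0 : ℝ) = lam * ∑ z, (N z : ℝ) * c z ^ 2 := by
    rw [remainingVar]
    push_cast
    simp
  have hv0 : remainingVar lam c N 0 ≠ 0 := by
    rw [← NNReal.coe_ne_zero, hv]
    have : (0 : ℝ) < lam := hlam
    positivity
  rw [← hv]
  refine le_trans ?_ (gaussianReal_apply_le 0 hv0 a W)
  refine le_trans ?_ (lintegral_hitProb_le_gaussianReal hεm hεlaw hεind hQ c N hB n)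
  have hm : Measurable fun ω => (weightedNoise Q ε c n ω, visitsTo Q ω n) :=
    ((measurable_weightedNoise hεm hQ c n).prodMk (measurable_visitsTo hQ n)).mono (ℱ.le n) le_rfl
  refine meas_le_lintegral₀ ((measurable_hitProb lam c N hB).comp hm).aemeasurable ?_
  -- On the event the prescribed visits are used up: no variance remains, the conditional law is a
  -- Dirac mass in B, and `hitProb` equals 1.
  rintro ω ⟨h1, h2⟩
  rw [Function.comp_apply, h1, hitProb, if_pos le_rfl]
  have : remainingVar lam c N N = 0 := by simp [remainingVar]
  simp only [this, gaussianReal_zero_var]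
  rw [Measure.dirac_apply' _ hB, Set.indicator_of_mem (by exact h2)]
  rfl

/-- Chernoff bounds with exponents 2 and -2 give tails of order n⁻², which suffices for
Borel–Cantelli. -/
lemma eventually_abs_noise_le_log (hε : ∀ n, Measurable (ε n))
    (hεlaw : ∀ n, P.map (ε n) = gaussianReal 0 lam) :
    ∀ᵐ ω ∂P, ∀ᶠ n : ℕ in Filter.atTop, |ε n ω| ≤ Real.log n := by
  set C : ℝ := Real.exp ((lam : ℝ) * 2 ^ 2 / 2) with hC
  have key (n : ℕ) (hn : 1 ≤ n) :
      P {ω | Real.log n < |ε n ω|} ≤ ENNReal.ofReal (2 * C * (1 / (n : ℝ) ^ 2)) := by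
    have hn' : (0 : ℝ) < n := by exact_mod_cast hn
    have hexp : Real.exp (-2 * Real.log n) = 1 / (n : ℝ) ^ 2 := by
      rw [mul_comm, ← Real.rpow_def_of_pos hn', Real.rpow_neg hn'.le, one_div]
      norm_num
    have hint (t : ℝ) : Integrable (fun ω => Real.exp (t * ε n ω)) P := by
      have := integrable_exp_mul_gaussianReal (μ := 0) (v := lam) t
      rw [← hεlaw n] at this
      exact this.comp_measurable (hε n)
    have h1 := measure_ge_le_exp_mul_mgf (μ := P) (X := ε n) (t := 2) (Real.log n) (by norm_num)
      (hint 2)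
    have h2 := measure_le_le_exp_mul_mgf (μ := P) (X := ε n) (t := -2) (-Real.log n) (by norm_num)
      (hint (-2))
    rw [mgf_gaussianReal (hεlaw n), hexp] at h1
    rw [mgf_gaussianReal (hεlaw n), neg_neg, mul_neg, ← neg_mul, hexp] at h2
    have e1 : Real.exp (0 * 2 + (lam : ℝ) * 2 ^ 2 / 2) = C := by rw [hC]; ring_nf
    have e2 : Real.exp (0 * -2 + (lam : ℝ) * (-2) ^ 2 / 2) = C := by rw [hC]; ring_nf
    rw [e1] at h1
    rw [e2] at h2
    have hsub : {ω | Real.log n < |ε n ω|} ⊆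
        {ω | Real.log n ≤ ε n ω} ∪ {ω | ε n ω ≤ -Real.log n} := by
      intro ω hω
      rcases lt_abs.1 (show Real.log n < |ε n ω| from hω) with h | h
      · exact Or.inl h.le
      · exact Or.inr (by simp only [Set.mem_ofPred_eq]; linarith)
    have h3 : P.real {ω | Real.log n < |ε n ω|} ≤ 2 * C * (1 / (n : ℝ) ^ 2) :=
      (measureReal_mono hsub).trans ((measureReal_union_le _ _).trans (by linarith))
    rw [measureReal_def] at h3
    exact (ENNReal.le_ofReal_iff_toReal_le (measure_ne_top _ _) (by positivity)).2 h3
  have hs : Summable fun n : ℕ => 2 * C * (1 / (n : ℝ) ^ 2) :=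
    (Real.summable_one_div_nat_pow.2 (by norm_num)).mul_left _
  have hsum : ∑' n : ℕ, P {ω | 1 ≤ n ∧ Real.log n < |ε n ω|} ≠ ⊤ := by
    refine ne_top_of_le_ne_top hs.tsum_ofReal_ne_top (ENNReal.tsum_le_tsum fun n => ?_)
    by_cases hn : 1 ≤ n
    · simpa [hn] using key n hn
    · simp [hn]
  filter_upwards [ae_eventually_notMem hsum] with ω hω
  filter_upwards [hω, Filter.eventually_ge_atTop 1] with n h1 h2
  by_contra h3
  exact h1 ⟨h2, not_le.1 h3⟩

end AntiConcentration

/-! ### Near ties are almost surely avoided. -/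

section NearTies

open MeasureTheory ProbabilityTheory Filter

lemma eventually_log_pow_le (m : ℕ) {s : ℝ} (hs : 0 < s) {c : ℝ} (hc : 0 < c) :
    ∀ᶠ n : ℕ in atTop, Real.log n ^ m ≤ c * (n : ℝ) ^ s := by
  have h := ((isLittleO_log_rpow_rpow_atTop (m : ℝ) hs).comp_tendsto
    tendsto_natCast_atTop_atTop).bound hc
  filter_upwards [h, eventually_ge_atTop 1] with n hn h1
  have h1' : (1 : ℝ) ≤ n := by exact_mod_cast h1
  simp only [Function.comp_apply, Real.rpow_natCast, Real.norm_eq_abs] at hn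
  rwa [abs_of_nonneg (pow_nonneg (Real.log_nonneg h1') m),
    abs_of_nonneg (Real.rpow_nonneg (by linarith) s)] at hn

lemma eventually_le_log (C : ℝ) : ∀ᶠ n : ℕ in atTop, C ≤ Real.log n :=
  (Real.tendsto_log_atTop.comp tendsto_natCast_atTop_atTop).eventually_ge_atTop C

/-- Number of visit vectors times the probability for each: polylogarithmic factors times n^(-5/4).
The former are absorbed by n^(1/8), which leaves n^(-9/8). -/
lemma summable_near_tie_bound (A : ℝ) (m : ℕ) :
    Summable fun n : ℕ => A * ((⌊Real.log n ^ 2⌋₊ + 1 : ℕ) : ℝ) ^ m *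
      (Real.log n ^ 2 / (n : ℝ) ^ 2 * (n : ℝ) ^ (3 / 4 : ℝ)) := by
  have hs : Summable fun n : ℕ => (n : ℝ) ^ (-(9 / 8) : ℝ) :=
    Real.summable_nat_rpow.2 (by norm_num)
  refine summable_of_isBigO_nat hs (Asymptotics.IsBigO.of_bound |A| ?_)
  filter_upwards [eventually_log_pow_le (3 * m + 2) (s := 1 / 8) (by norm_num) one_pos,
    eventually_le_log 2, eventually_ge_atTop 1] with n h1 h2 h3
  have hn : (0 : ℝ) < n := by exact_mod_cast h3
  set l := Real.log n
  have hfl : ((⌊l ^ 2⌋₊ + 1 : ℕ) : ℝ) ≤ l ^ 3 := by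
    push_cast
    have := Nat.floor_le (sq_nonneg l)
    nlinarith [sq_nonneg l]
  rw [norm_mul, norm_mul, Real.norm_eq_abs A, mul_assoc]
  refine mul_le_mul_of_nonneg_left ?_ (abs_nonneg A)
  rw [Real.norm_of_nonneg (by positivity), Real.norm_of_nonneg (by positivity),
    Real.norm_of_nonneg (by positivity)]
  have e : l ^ 2 / (n : ℝ) ^ 2 * (n : ℝ) ^ (3 / 4 : ℝ) = l ^ 2 * (n : ℝ) ^ (-(5 / 4) : ℝ) := by
    rw [← Real.rpow_natCast (n : ℝ) 2, div_eq_mul_inv, ← Real.rpow_neg hn.le, mul_assoc,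
      ← Real.rpow_add hn]
    norm_num
  calc ((⌊l ^ 2⌋₊ + 1 : ℕ) : ℝ) ^ m * (l ^ 2 / (n : ℝ) ^ 2 * (n : ℝ) ^ (3 / 4 : ℝ))
      ≤ (l ^ 3) ^ m * (l ^ 2 * (n : ℝ) ^ (-(5 / 4) : ℝ)) := by
        rw [e]; gcongr
    _ = l ^ (3 * m + 2) * (n : ℝ) ^ (-(5 / 4) : ℝ) := by rw [pow_add, pow_mul]; ring
    _ ≤ 1 * (n : ℝ) ^ (1 / 8 : ℝ) * (n : ℝ) ^ (-(5 / 4) : ℝ) := by gcongr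
    _ = (n : ℝ) ^ (-(9 / 8) : ℝ) := by rw [one_mul, ← Real.rpow_add hn]; norm_num

variable {Ω ι α : Type*} {mΩ : MeasurableSpace Ω} {P : Measure Ω} [IsProbabilityMeasure P]
  [Fintype ι] [DecidableEq ι] [MeasurableSpace ι] [MeasurableSingletonClass ι] [Fintype α]
  {ℱ : Filtration ℕ mΩ} {ε : ℕ → Ω → ℝ} {lam : ℝ≥0} {Q : ℕ → Ω → ι}

/-- The visit numbers of `n` rounds in terms of those of the points other than `z₀`. -/
def completeCounts (z₀ : ι) (n : ℕ) {L : ℕ} (M : ι → Fin L) : ι → ℕ := fun z =>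
  if z = z₀ then n - ∑ w ∈ Finset.univ.erase z₀, (M w : ℕ) else M z

/-- The total n determines the entry at z₀, which is the only one that may be large; so few vectors
need to enter the union bound. -/
lemma exists_completeCounts_eq (z₀ : ι) {n L : ℕ} {N : ι → ℕ} (hN : ∑ z, N z = n)
    (hL : ∀ z, z ≠ z₀ → N z ≤ L) :
    ∃ M : ι → Fin (L + 1), N = completeCounts z₀ n M := by
  refine ⟨fun z => Fin.ofNat (L + 1) (N z), ?_⟩
  have h (z : ι) (hz : z ≠ z₀) : (Fin.ofNat (L + 1) (N z) : ℕ) = N z :=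
    Nat.mod_eq_of_lt (Nat.lt_succ_of_le (hL z hz))
  ext z
  rw [completeCounts]
  split_ifs with hz
  · subst hz
    rw [Finset.sum_congr rfl fun w hw => h w (Finset.ne_of_mem_erase hw)]
    rw [← Finset.add_sum_erase _ _ (Finset.mem_univ z)] at hN
    exact (Nat.sub_eq_of_eq_add hN.symm).symm
  · exact (h z hz).symm

/-- Almost surely, weighted noise with weights that are not too small does not come within
`(log n)² / n²` of prescribed values when all points but one are visited at most `(log n)²`
times. -/
lemma eventually_not_near_tie (hεm : ∀ n, Measurable[ℱ (n + 1)] (ε n))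
    (hεlaw : ∀ n, P.map (ε n) = gaussianReal 0 lam)
    (hεind : ∀ n, Indep (MeasurableSpace.comap (ε n) inferInstance) (ℱ n) P)
    (hQ : ∀ n, Measurable[ℱ n] (Q n)) (hlam : 0 < lam) (z₀ : ι)
    (c : α → (ι → ℕ) → ι → ℝ) (a : α → (ι → ℕ) → ℕ → ℝ) :
    ∀ᵐ ω ∂P, ∀ᶠ n : ℕ in atTop, ∀ p : α,
      (∀ z, z ≠ z₀ → (visitsTo Q ω n z : ℝ) ≤ Real.log n ^ 2) →
      (n : ℝ) ^ (-(3 / 2) : ℝ) ≤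
        ∑ z, (visitsTo Q ω n z : ℝ) * c p (visitsTo Q ω n) z ^ 2 →
      Real.log n ^ 2 / (n : ℝ) ^ 2 <
        |a p (visitsTo Q ω n) n + weightedNoise Q ε (c p (visitsTo Q ω n)) n ω| := by
  set L : ℕ → ℕ := fun n => ⌊Real.log n ^ 2⌋₊ with hL
  set W : ℕ → ℝ := fun n => Real.log n ^ 2 / (n : ℝ) ^ 2 with hW
  have hl : (0 : ℝ) < lam := hlam
  -- The clause 1 ≤ n matters: at n = 0 the real power is 0 by convention and would not force a
  -- positive spread.
  let S : ℕ → α → (ι → ℕ) → Set Ω := fun n p N =>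
    {ω | (1 ≤ n ∧ (n : ℝ) ^ (-(3 / 2) : ℝ) ≤ ∑ z, (N z : ℝ) * c p N z ^ 2) ∧
      (visitsTo Q ω n = N ∧ |a p N n + weightedNoise Q ε (c p N) n ω| ≤ W n)}
  have hS (n : ℕ) (p : α) (N : ι → ℕ) : P (S n p N) ≤
      ENNReal.ofReal (2 / √(2 * Real.pi * lam) * (W n * (n : ℝ) ^ (3 / 4 : ℝ))) := by
    by_cases h : 1 ≤ n ∧ (n : ℝ) ^ (-(3 / 2) : ℝ) ≤ ∑ z, (N z : ℝ) * c p N z ^ 2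
    · have hn : (0 : ℝ) < n := by exact_mod_cast h.1
      have hpos : (0 : ℝ) < (n : ℝ) ^ (-(3 / 2) : ℝ) := Real.rpow_pos_of_pos hn _
      refine (measure_mono fun ω hω => hω.2).trans ((measure_weightedNoise_le hεm hεlaw hεind hQ
        hlam (c p N) N (hpos.trans_le h.2) (a p N n) (W n) n).trans
        (ENNReal.ofReal_le_ofReal ?_))
      have e : √(2 * Real.pi * (lam * (n : ℝ) ^ (-(3 / 2) : ℝ))) =
          √(2 * Real.pi * lam) * (n : ℝ) ^ (-(3 / 4) : ℝ) := by
        rw [← mul_assoc, Real.sqrt_mul (by positivity), Real.sqrt_eq_rpow ((n : ℝ) ^ _),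
          ← Real.rpow_mul hn.le]
        norm_num
      calc 2 * W n / √(2 * Real.pi * (lam * ∑ z, (N z : ℝ) * c p N z ^ 2))
          ≤ 2 * W n / √(2 * Real.pi * (lam * (n : ℝ) ^ (-(3 / 2) : ℝ))) := by
            have : 0 ≤ W n := by positivity
            have := h.2
            gcongr
        _ = 2 / √(2 * Real.pi * lam) * (W n * (n : ℝ) ^ (3 / 4 : ℝ)) := by
            rw [e, Real.rpow_neg hn.le]
            field_simp
    · have : S n p N = ∅ := Set.eq_empty_of_forall_notMem fun ω hω => h hω.1
      rw [this, measure_empty]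
      exact zero_le
  have hU (n : ℕ) : P (⋃ x : α × (ι → Fin (L n + 1)), S n x.1 (completeCounts z₀ n x.2)) ≤
      ENNReal.ofReal ((Fintype.card α * (2 / √(2 * Real.pi * lam))) *
        ((⌊Real.log n ^ 2⌋₊ + 1 : ℕ) : ℝ) ^ Fintype.card ι *
        (Real.log n ^ 2 / (n : ℝ) ^ 2 * (n : ℝ) ^ (3 / 4 : ℝ))) := by
    refine (measure_iUnion_fintype_le _ _).trans ((Finset.sum_le_sum fun x _ =>
      hS n x.1 (completeCounts z₀ n x.2)).trans ?_)
    rw [Finset.sum_const, Finset.card_univ, Fintype.card_prod, Fintype.card_fun, Fintype.card_fin,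
      nsmul_eq_mul, ← ENNReal.ofReal_natCast, ← ENNReal.ofReal_mul (by positivity)]
    refine ENNReal.ofReal_le_ofReal (le_of_eq ?_)
    simp only [hW, hL]
    push_cast
    ring
  have hsum : ∑' n, P (⋃ x : α × (ι → Fin (L n + 1)), S n x.1 (completeCounts z₀ n x.2)) ≠ ⊤ :=
    ne_top_of_le_ne_top (summable_near_tie_bound _ _).tsum_ofReal_ne_top (ENNReal.tsum_le_tsum hU)
  filter_upwards [ae_eventually_notMem hsum] with ω hω
  filter_upwards [hω, eventually_ge_atTop 1] with n hn h1 p hbox hspread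
  by_contra hlt
  obtain ⟨M, hM⟩ := exists_completeCounts_eq z₀ (sum_visitsTo Q ω n)
    fun z hz => Nat.le_floor (hbox z hz)
  refine hn (Set.mem_iUnion.2 ⟨(p, M), ?_⟩)
  change ω ∈ S n p (completeCounts z₀ n M)
  rw [← hM]
  exact ⟨⟨h1, hspread⟩, rfl, not_lt.1 hlt⟩

end NearTies

/-! ### Distance of the augmented posterior from the standard one. -/

section Augmentation

variable {E : Type*} {k : E → E → ℝ} {lam : ℝ≥0} {n : ℕ} {X : Fin n → E} {y : Fin n → ℝ}
  {gam : ℝ} {m : E → ℝ} {v : E → ℝ≥0} {x : E}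

lemma mul_postVar_le_prefVar :
    gam * (n : ℝ) ^ 2 * postVar k lam X x ≤ prefVar k lam X y gam v x :=
  le_add_of_nonneg_left (sq_nonneg _)

/-- The weight of the user belief in the preference-augmented posterior decays like `1 / n²`. -/
lemma postVar_div_le (hs : 0 ≤ postVar k lam X x) (hT : 0 < gam * (n : ℝ) ^ 2) :
    postVar k lam X x / (prefVar k lam X y gam v x + postVar k lam X x) ≤
      1 / (gam * (n : ℝ) ^ 2) := by
  have hP := mul_postVar_le_prefVar (k := k) (lam := lam) (X := X) (y := y) (gam := gam)
    (v := v) (x := x)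
  set s := postVar k lam X x
  set V := prefVar k lam X y gam v x
  set T := gam * (n : ℝ) ^ 2
  rcases hs.eq_or_lt with h | h
  · rw [← h, zero_div]; positivity
  · have hV : 0 < V := (mul_pos hT h).trans_le hP
    rw [div_le_div_iff₀ (by positivity) hT]
    nlinarith

lemma augVar_eq (hs : 0 ≤ postVar k lam X x) (hT : 0 < gam * (n : ℝ) ^ 2) :
    augVar k lam X y gam v x = postVar k lam X x *
      (1 - postVar k lam X x / (prefVar k lam X y gam v x + postVar k lam X x)) := by
  have hP := mul_postVar_le_prefVar (k := k) (lam := lam) (X := X) (y := y) (gam := gam)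
    (v := v) (x := x)
  rw [augVar]
  set s := postVar k lam X x
  set V := prefVar k lam X y gam v x
  set T := gam * (n : ℝ) ^ 2
  rcases hs.eq_or_lt with h | h
  · simp [← h]
  · have hV : 0 < V := (mul_pos hT h).trans_le hP
    field_simp
    ring

lemma abs_augVar_sub_le (hs : 0 ≤ postVar k lam X x) (hT : 0 < gam * (n : ℝ) ^ 2) :
    |augVar k lam X y gam v x - postVar k lam X x| ≤
      postVar k lam X x / (gam * (n : ℝ) ^ 2) := by
  have h1 := postVar_div_le (y := y) (v := v) hs hT
  have hP := mul_postVar_le_prefVar (k := k) (lam := lam) (X := X) (y := y) (gam := gam)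
    (v := v) (x := x)
  rw [augVar_eq hs hT]
  set s := postVar k lam X x
  set V := prefVar k lam X y gam v x
  have hV : 0 ≤ V := le_trans (mul_nonneg hT.le hs) hP
  have h0 : 0 ≤ s / (V + s) := by positivity
  rw [show s * (1 - s / (V + s)) - s = -(s * (s / (V + s))) by ring, abs_neg,
    abs_of_nonneg (mul_nonneg hs h0), div_eq_mul_one_div s (gam * _)]
  exact mul_le_mul_of_nonneg_left h1 hs

lemma abs_sqrt_augVar_sub_le (hs : 0 ≤ postVar k lam X x) (hT : 1 ≤ gam * (n : ℝ) ^ 2) :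
    |√(augVar k lam X y gam v x) - √(postVar k lam X x)| ≤
      √(postVar k lam X x) / (gam * (n : ℝ) ^ 2) := by
  have hT0 : 0 < gam * (n : ℝ) ^ 2 := by linarith
  have h1 := postVar_div_le (y := y) (v := v) hs hT0
  have hP := mul_postVar_le_prefVar (k := k) (lam := lam) (X := X) (y := y) (gam := gam)
    (v := v) (x := x)
  rw [augVar_eq hs hT0]
  set s := postVar k lam X x
  set V := prefVar k lam X y gam v x
  have hV : 0 ≤ V := le_trans (mul_nonneg hT0.le hs) hP
  have h0 : 0 ≤ s / (V + s) := by positivity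
  have hle : s / (V + s) ≤ 1 := h1.trans ((div_le_one hT0).2 hT)
  set θ := s / (V + s)
  rw [Real.sqrt_mul hs, abs_sub_comm,
    show √s - √s * √(1 - θ) = √s * (1 - √(1 - θ)) by ring, div_eq_mul_one_div (√s)]
  have h2 : 1 - θ ≤ √(1 - θ) := by
    refine Real.le_sqrt_of_sq_le ?_
    nlinarith
  have h3 : √(1 - θ) ≤ 1 := Real.sqrt_le_one.2 (by linarith)
  rw [abs_of_nonneg (mul_nonneg (Real.sqrt_nonneg _) (by linarith))]
  exact mul_le_mul_of_nonneg_left (by linarith) (Real.sqrt_nonneg _)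

/-- For positive variance the augmented mean is a convex combination, so it moves by the belief
weight times the difference of the two means. At zero variance the convention z / 0 = 0 makes it
vanish, hence the hypothesis `h0`. -/
lemma abs_augMean_sub_le (hs : 0 ≤ postVar k lam X x) (hT : 0 < gam * (n : ℝ) ^ 2)
    (h0 : postVar k lam X x = 0 → postMean k lam X y x = 0) :
    |augMean k lam X y gam m v x - postMean k lam X y x| ≤
      (|prefMean y m x| + |postMean k lam X y x|) / (gam * (n : ℝ) ^ 2) := by
  have h1 := postVar_div_le (y := y) (v := v) hs hT
  have hP := mul_postVar_le_prefVar (k := k) (lam := lam) (X := X) (y := y) (gam := gam)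
    (v := v) (x := x)
  rw [augMean, augVar]
  set s := postVar k lam X x
  set V := prefVar k lam X y gam v x
  set μ := postMean k lam X y x
  set ν := prefMean y m x
  set T := gam * (n : ℝ) ^ 2
  rcases hs.eq_or_lt with h | h
  · have hμ : μ = 0 := h0 h.symm
    simp only [← h, hμ, mul_zero, zero_div, zero_mul, add_zero, sub_zero, abs_zero]
    positivity
  · have hV : 0 < V := (mul_pos hT h).trans_le hP
    have e : V * s / (V + s) / V * ν + V * s / (V + s) / s * μ - μ = s / (V + s) * (ν - μ) := by
      field_simp
      ring
    rw [e, abs_mul, abs_of_nonneg (by positivity : 0 ≤ s / (V + s)),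
      div_eq_mul_one_div (|ν| + |μ|), mul_comm]
    exact mul_le_mul (abs_sub ν μ) h1 (by positivity) (by positivity)

lemma abs_obsMean_le {Y : ℝ} (hY : 0 ≤ Y) (h : ∀ i, |y i| ≤ Y) : |obsMean y| ≤ Y := by
  rcases Nat.eq_zero_or_pos n with rfl | hn
  · simpa [obsMean] using hY
  · have hn' : (0 : ℝ) < n := by exact_mod_cast hn
    rw [obsMean, abs_div, Nat.abs_cast, div_le_iff₀ hn']
    refine (Finset.abs_sum_le_sum_abs _ _).trans ((Finset.sum_le_sum fun i _ => h i).trans_eq ?_)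
    simp [mul_comm]

lemma sqrt_obsVar_le {Y : ℝ} (hY : 0 ≤ Y) (h : ∀ i, |y i| ≤ Y) : √(obsVar y) ≤ 2 * Y := by
  have hm := abs_le.1 (abs_obsMean_le hY h)
  refine Real.sqrt_le_iff.2 ⟨by positivity, ?_⟩
  rcases Nat.eq_zero_or_pos n with rfl | hn
  · simp only [obsVar, Finset.univ_eq_empty, Finset.sum_empty, zero_div]; positivity
  · have hn' : (0 : ℝ) < n := by exact_mod_cast hn
    rw [obsVar, div_le_iff₀ hn']
    refine (Finset.sum_le_sum (g := fun _ => (2 * Y) ^ 2) fun i _ => ?_).trans_eq ?_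
    · have hi := abs_le.1 (h i)
      exact sq_le_sq' (by linarith) (by linarith)
    · simp [mul_comm]

lemma abs_prefMean_le {Y B : ℝ} (hY : 0 ≤ Y) (h : ∀ i, |y i| ≤ Y) (hB : |m x| ≤ B) :
    |prefMean y m x| ≤ Y * (B + 2) := by
  rw [prefMean, scale]
  refine (abs_add_le _ _).trans ?_
  rw [abs_mul, abs_of_nonneg (Real.sqrt_nonneg _)]
  have h1 := mul_le_mul (abs_obsMean_le hY h) hB (abs_nonneg _) hY
  have h2 := sqrt_obsVar_le hY h
  linarith

end Augmentation

/-! ### Gaps between upper confidence bounds. -/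

section Gap

variable {E κ : Type*} [Fintype κ] [DecidableEq κ] {D : Finset E} [DecidableEq D]
  {k : E → E → ℝ} {φ : D → κ → ℝ} {lam : ℝ≥0}

lemma postVar_nonneg (hφ : ∀ x y : D, k x y = φ x ⬝ᵥ φ y) (hlam : 0 < lam)
    {n : ℕ} (Q : Fin n → D) (x : D) : 0 ≤ postVar k lam (fun i => (Q i : E)) x := by
  rw [postVar_eq hφ hlam]
  exact mul_nonneg lam.2 (infoSolve_quadratic_nonneg φ _ hlam _)

lemma postVar_le (hφ : ∀ x y : D, k x y = φ x ⬝ᵥ φ y) (hlam : 0 < lam)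
    {n : ℕ} (Q : Fin n → D) (x : D) : postVar k lam (fun i => (Q i : E)) x ≤ k x x := by
  rw [postVar_eq hφ hlam, hφ]
  exact infoSolve_quadratic_le φ _ hlam _

lemma visits_mul_postVar_le (hφ : ∀ x y : D, k x y = φ x ⬝ᵥ φ y) (hlam : 0 < lam)
    {n : ℕ} (Q : Fin n → D) (x : D) :
    (visits Q x : ℝ) * postVar k lam (fun i => (Q i : E)) x ≤ lam := by
  rw [postVar_eq hφ hlam, mul_left_comm]
  exact mul_le_of_le_one_right lam.2 (mul_infoSolve_quadratic_le_one φ _ hlam _)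

lemma postMean_eq_zero_of_postVar (hφ : ∀ x y : D, k x y = φ x ⬝ᵥ φ y) (hlam : 0 < lam)
    {n : ℕ} (Q : Fin n → D) (y : Fin n → ℝ) (x : D)
    (h : postVar k lam (fun i => (Q i : E)) x = 0) :
    postMean k lam (fun i => (Q i : E)) y x = 0 := by
  have hl : (lam : ℝ) ≠ 0 := by exact_mod_cast hlam.ne'
  rw [postVar_eq hφ hlam] at h
  have h0 := infoSolve_quadratic_eq_zero φ _ hlam ((mul_eq_zero.1 h).resolve_left hl)
  rw [postMean_eq hφ hlam, h0, infoSolve, Matrix.mulVec_zero]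
  simp

lemma postMean_sub (hφ : ∀ x y : D, k x y = φ x ⬝ᵥ φ y) (hlam : 0 < lam)
    {n : ℕ} (Q : Fin n → D) (y : Fin n → ℝ) (x x' : D) :
    postMean k lam (fun i => (Q i : E)) y x - postMean k lam (fun i => (Q i : E)) y x' =
      ∑ i, (φ (Q i) ⬝ᵥ infoSolve φ lam (visits Q) (φ x - φ x')) * y i := by
  rw [postMean_eq hφ hlam, postMean_eq hφ hlam, infoSolve_sub, ← Finset.sum_sub_distrib]
  exact Finset.sum_congr rfl fun i _ => by rw [dotProduct_sub]; ring

lemma abs_postMean_sub_le (hφ : ∀ x y : D, k x y = φ x ⬝ᵥ φ y) (hlam : 0 < lam)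
    {n : ℕ} (Q : Fin n → D) {y : Fin n → ℝ} (x x' : D) {Y : ℝ} (hY0 : 0 ≤ Y)
    (hY : ∀ i, |y i| ≤ Y) :
    |postMean k lam (fun i => (Q i : E)) y x - postMean k lam (fun i => (Q i : E)) y x'| ≤
      √(weightSq φ lam (visits Q) (φ x - φ x')) * (√n * Y) := by
  rw [postMean_sub hφ hlam]
  refine Real.abs_le_sqrt (Finset.sum_mul_sq_le_sq_mul_sq _ _ _) |>.trans ?_
  rw [Real.sqrt_mul (Finset.sum_nonneg fun _ _ => sq_nonneg _), weightSq, sum_visits_mul Q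
    fun z => (φ z ⬝ᵥ infoSolve φ lam (visits Q) (φ x - φ x')) ^ 2]
  refine mul_le_mul_of_nonneg_left ?_ (Real.sqrt_nonneg _)
  refine Real.sqrt_le_iff.2 ⟨by positivity, ?_⟩
  rw [mul_pow, Real.sq_sqrt (Nat.cast_nonneg n)]
  refine (Finset.sum_le_sum (g := fun _ => Y ^ 2) fun i _ => ?_).trans_eq (by simp)
  exact sq_le_sq' (abs_le.1 (hY i)).1 (abs_le.1 (hY i)).2

/-- If `x` has been visited and the observations hardly inform about the difference of the values
at `x` and `x'`, then the posterior variance at `x'` exceeds that at `x`. -/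
lemma postVar_sub_ge (hφ : ∀ x y : D, k x y = φ x ⬝ᵥ φ y) (hlam : 0 < lam)
    {n : ℕ} (Q : Fin n → D) {x x' : D} (hx : 0 < visits Q x) {A M : ℝ} (hA : 0 < A)
    (hAx : A ≤ (φ x - φ x') ⬝ᵥ (φ x - φ x')) (hM : ∀ z, (φ z ⬝ᵥ (φ x - φ x')) ^ 2 ≤ M)
    (hS1 : weightSq φ lam (visits Q) (φ x - φ x') * (n * M) < A ^ 2 / 4)
    (hS2 : 2 * lam * √(weightSq φ lam (visits Q) (φ x - φ x')) ≤ A / 4) :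
    A / 4 ≤ postVar k lam (fun i => (Q i : E)) x' - postVar k lam (fun i => (Q i : E)) x := by
  have hl : (0 : ℝ) < lam := hlam
  rw [postVar_eq hφ hlam, postVar_eq hφ hlam, ← mul_sub, infoSolve_quadratic_sub φ _ hl]
  have hcs := sq_sub_le_weightSq_mul φ (visits Q) hl (φ x - φ x')
  have hw := weight_sq_le φ (lam := lam) (visits Q) (φ x - φ x') hx
  have hS0 := weightSq_nonneg φ (lam := lam) (visits Q) (φ x - φ x')
  have hsum : ∑ z, (visits Q z : ℝ) * (φ z ⬝ᵥ (φ x - φ x')) ^ 2 ≤ n * M := by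
    rw [sum_visits_mul Q fun z => (φ z ⬝ᵥ (φ x - φ x')) ^ 2]
    exact (Finset.sum_le_sum fun i _ => hM (Q i)).trans_eq (by simp)
  set a := φ x - φ x'
  set u := infoSolve φ lam (visits Q) a
  set S := weightSq φ lam (visits Q) a
  have h1 : φ x ⬝ᵥ u ≤ √S := Real.le_sqrt_of_sq_le hw
  -- Otherwise the explained part of a ⬝ᵥ a exceeds A / 2, contradicting Cauchy–Schwarz and `hS1`.
  have h2 : A / 2 ≤ lam * (a ⬝ᵥ u) := by
    by_contra hc
    push Not at hc
    have h3 : (A / 2) ^ 2 ≤ (a ⬝ᵥ a - lam * (a ⬝ᵥ u)) ^ 2 :=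
      pow_le_pow_left₀ (by positivity) (by linarith) 2
    have h4 := mul_le_mul_of_nonneg_left hsum hS0
    nlinarith
  nlinarith

/-- The exploration terms differ because the variances do (`postVar_sub_ge`); the means can offset
this only by the Cauchy–Schwarz bound on their difference. -/
lemma ucb_gap (hφ : ∀ x y : D, k x y = φ x ⬝ᵥ φ y) (hlam : 0 < lam)
    {n : ℕ} (Q : Fin n → D) {x x' : D} (hx : 0 < visits Q x) {A M K : ℝ} (hA : 0 < A)
    (hAx : A ≤ (φ x - φ x') ⬝ᵥ (φ x - φ x')) (hM : ∀ z, (φ z ⬝ᵥ (φ x - φ x')) ^ 2 ≤ M)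
    (hK0 : 0 < K) (hK : ∀ z : D, k z z ≤ K)
    (hS1 : weightSq φ lam (visits Q) (φ x - φ x') * (n * M) < A ^ 2 / 4)
    (hS2 : 2 * lam * √(weightSq φ lam (visits Q) (φ x - φ x')) ≤ A / 4)
    {y : Fin n → ℝ} {Y : ℝ} (hY0 : 0 ≤ Y) (hY : ∀ i, |y i| ≤ Y) (b : ℝ) :
    √b * (A / (8 * √K)) - √(weightSq φ lam (visits Q) (φ x - φ x')) * (√n * Y) ≤
      |ucb k lam (fun i => (Q i : E)) y b x - ucb k lam (fun i => (Q i : E)) y b x'| := by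
  have h1 := postVar_sub_ge hφ hlam Q hx hA hAx hM hS1 hS2
  have h2 := abs_le.1 (abs_postMean_sub_le hφ hlam Q x x' hY0 hY)
  have h3 := postVar_nonneg hφ hlam Q x
  have h4 := (postVar_le hφ hlam Q x').trans (hK x')
  rw [abs_sub_comm, ucb, ucb]
  set s := postVar k lam (fun i => (Q i : E)) x
  set s' := postVar k lam (fun i => (Q i : E)) x'
  have hK' := Real.sqrt_pos.2 hK0
  have h5 : √s ≤ √K := Real.sqrt_le_sqrt (by linarith)
  have h6 : √s' ≤ √K := Real.sqrt_le_sqrt h4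
  have h7 : √s ≤ √s' := Real.sqrt_le_sqrt (by linarith)
  -- Factor s' - s ≥ A / 4 as a difference of squares whose sum factor is at most 2 √K.
  have h8 : A / (8 * √K) ≤ √s' - √s := by
    rw [div_le_iff₀ (by positivity)]
    have e1 := Real.mul_self_sqrt h3
    have e2 := Real.mul_self_sqrt (show 0 ≤ s' by linarith)
    nlinarith
  have h9 := mul_le_mul_of_nonneg_left h8 (Real.sqrt_nonneg b)
  refine le_trans ?_ (le_abs_self _)
  linarith

/-- The part of the difference of two upper confidence bounds that depends on the observations only
through the visit numbers. -/
def gapCenter (φ : D → κ → ℝ) (lam : ℝ) (f : E → ℝ) (b : ℝ) (x x' : D) (N : D → ℕ) : ℝ :=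
  ∑ z, (N z : ℝ) * ((φ z ⬝ᵥ infoSolve φ lam N (φ x - φ x')) * f z) +
    √b * (√(lam * (φ x ⬝ᵥ infoSolve φ lam N (φ x))) -
      √(lam * (φ x' ⬝ᵥ infoSolve φ lam N (φ x'))))

/-- This is the form that anti-concentration needs: once the visit numbers are fixed, the centre and
the weights are deterministic. -/
lemma ucb_sub_eq (hφ : ∀ x y : D, k x y = φ x ⬝ᵥ φ y) (hlam : 0 < lam) {Ω : Type*}
    (f : E → ℝ) (Q : ℕ → Ω → D) (ε : ℕ → Ω → ℝ) (ω : Ω) (n : ℕ) (b : ℝ) (x x' : D) :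
    ucb k lam (inputs (fun n ω => (Q n ω : E)) ω n)
        (outputs f (fun n ω => (Q n ω : E)) ε ω n) b x -
      ucb k lam (inputs (fun n ω => (Q n ω : E)) ω n)
        (outputs f (fun n ω => (Q n ω : E)) ε ω n) b x' =
      gapCenter φ lam f b x x' (visitsTo Q ω n) + weightedNoise Q ε
        (fun z => φ z ⬝ᵥ infoSolve φ lam (visitsTo Q ω n) (φ x - φ x')) n ω := by
  have h := postMean_sub hφ hlam (fun i : Fin n => Q i ω)
    (outputs f (fun n ω => (Q n ω : E)) ε ω n) x x'
  have hv := postVar_eq hφ hlam (fun i : Fin n => Q i ω)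
  change postMean k lam (inputs (fun n ω => (Q n ω : E)) ω n) _ x -
    postMean k lam (inputs (fun n ω => (Q n ω : E)) ω n) _ x' = _ at h
  change ∀ x : D, postVar k lam (inputs (fun n ω => (Q n ω : E)) ω n) x = _ at hv
  rw [ucb, ucb, add_sub_add_comm, h, hv, hv, gapCenter]
  have e : weightedNoise Q ε
      (fun z => φ z ⬝ᵥ infoSolve φ lam (visitsTo Q ω n) (φ x - φ x')) n ω =
      ∑ i : Fin n, (φ (Q i ω) ⬝ᵥ infoSolve φ lam (visitsTo Q ω n) (φ x - φ x')) * ε i ω := by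
    rw [weightedNoise, Finset.sum_range]
  have e2 := sum_visits_mul (fun i : Fin n => Q i ω)
    (fun z => (φ z ⬝ᵥ infoSolve φ lam (visitsTo Q ω n) (φ x - φ x')) * f z)
  rw [e]
  change ∑ z, (visitsTo Q ω n z : ℝ) * _ = _ at e2
  rw [e2]
  change _ + _ = _ + √b * (_ - _) + _
  simp only [outputs, mul_add, Finset.sum_add_distrib]
  change ∑ i : Fin n, (φ (Q i ω) ⬝ᵥ infoSolve φ lam (visitsTo Q ω n) (φ x - φ x')) * _ +
    ∑ i : Fin n, (φ (Q i ω) ⬝ᵥ infoSolve φ lam (visitsTo Q ω n) (φ x - φ x')) * _ +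
    (√b * √(lam * (φ x ⬝ᵥ infoSolve φ lam (visitsTo Q ω n) (φ x))) -
      √b * √(lam * (φ x' ⬝ᵥ infoSolve φ lam (visitsTo Q ω n) (φ x')))) = _
  ring

end Gap

/-! ### Growth of visits, observations and exploration parameter; eventual agreement. -/

section Asymptotic

open Filter

lemma tendsto_log_div_sq : Tendsto (fun n : ℕ => Real.log n / (n : ℝ) ^ 2) atTop (nhds 0) := by
  have h := (isLittleO_log_rpow_atTop (r := 2) (by norm_num)).tendsto_div_nhds_zero
  simpa [Function.comp_def] using h.comp tendsto_natCast_atTop_atTop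

lemma tendsto_nat_rpow_neg {s : ℝ} (hs : 0 < s) :
    Tendsto (fun n : ℕ => (n : ℝ) ^ (-s)) atTop (nhds 0) :=
  (tendsto_rpow_neg_atTop hs).comp tendsto_natCast_atTop_atTop

lemma visitsTo_pos {ι Ω : Type*} [DecidableEq ι] (Q : ℕ → Ω → ι) (ω : Ω) {i n : ℕ} (h : i < n) :
    0 < visitsTo Q ω n (Q i ω) :=
  Finset.card_pos.2 (show (Finset.univ.filter fun j : Fin n => Q j ω = Q i ω).Nonempty from
    ⟨⟨i, h⟩, by simp⟩)

/-- The count changes only in rounds that query z, where it is controlled just beforehand; between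
such rounds the bound grows. The extra n₀ + 1 pays for the early rounds and for the current visit.
-/
lemma visitsTo_eventually_le_log_sq {ι Ω : Type*} [DecidableEq ι] (Q : ℕ → Ω → ι) (ω : Ω) (z : ι)
    (C : ℝ) (hC : 0 ≤ C)
    (h : ∀ᶠ n : ℕ in atTop, Q n ω = z → (visitsTo Q ω n z : ℝ) ≤ C * Real.log n) :
    ∀ᶠ n : ℕ in atTop, (visitsTo Q ω n z : ℝ) ≤ Real.log n ^ 2 := by
  obtain ⟨n₀, hn₀⟩ := eventually_atTop.1 h
  have key (n : ℕ) : (visitsTo Q ω n z : ℝ) ≤ n₀ + 1 + C * Real.log n := by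
    induction n with
    | zero => simp only [visitsTo_zero, Pi.zero_apply]; simp; positivity
    | succ n ih =>
      have hlog : Real.log n ≤ Real.log (n + 1 : ℕ) := by
        rcases Nat.eq_zero_or_pos n with rfl | hn
        · simp
        · exact Real.log_le_log (by exact_mod_cast hn) (by push_cast; linarith)
      have hlog' := mul_le_mul_of_nonneg_left hlog hC
      rw [visitsTo_succ]
      by_cases hz : Q n ω = z
      · rw [hz, Pi.add_apply, Pi.single_eq_same]
        push_cast at hlog' ⊢
        by_cases hn : n₀ ≤ n
        · have := hn₀ n hn hz
          have h0 : (0 : ℝ) ≤ n₀ := Nat.cast_nonneg _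
          linarith
        · have h1 : (visitsTo Q ω n z : ℝ) ≤ n₀ := by
            have : visitsTo Q ω n z ≤ n := (Finset.card_filter_le _ _).trans_eq (Finset.card_fin n)
            exact_mod_cast this.trans (not_le.1 hn).le
          have h2 : 0 ≤ C * Real.log (n + 1) :=
            mul_nonneg hC (Real.log_nonneg (by linarith [Nat.cast_nonneg (α := ℝ) n]))
          linarith
      · rw [Pi.add_apply, Pi.single_eq_of_ne (Ne.symm hz), add_zero]
        linarith
  filter_upwards [eventually_le_log (n₀ + 1 + C), eventually_le_log 1] with n h1 h2
  have := key n
  have h0 : (0 : ℝ) ≤ n₀ := Nat.cast_nonneg _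
  nlinarith

/-- Two sequences of candidates, one of which is visited in each round, eventually agree if distinct
candidates are nearly tied, while a visited point is not nearly tied with any other. -/
lemma eventually_eq_of_ties {ι Ω : Type*} [Finite ι] [DecidableEq ι] (Q : ℕ → Ω → ι) (ω : Ω)
    (x₁ x₂ : ℕ → ι) (U : ℕ → ι → ℝ) (W : ℕ → ℝ)
    (h1 : ∀ᶠ n in atTop, |U n (x₁ n) - U n (x₂ n)| ≤ W n)
    (h2 : ∀ᶠ n in atTop, ∀ x x', x ≠ x' → 0 < visitsTo Q ω n x → W n < |U n x - U n x'|)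
    (hq : ∀ n, Q n ω = x₁ n ∨ Q n ω = x₂ n) : ∀ᶠ n in atTop, x₁ n = x₂ n := by
  obtain ⟨n₀, hn₀⟩ := eventually_atTop.1 (h1.and h2)
  -- A late disagreement forces a first visit. Infinitely many disagreements would, by pigeonhole,
  -- make two of these first visits fall on the same point.
  have hbad (n : ℕ) (hn : n₀ ≤ n) (hne : x₁ n ≠ x₂ n) : visitsTo Q ω n (Q n ω) = 0 := by
    obtain ⟨ha, hb⟩ := hn₀ n hn
    by_contra hpos
    rcases hq n with h | h <;> rw [h] at hpos
    · exact absurd ha (not_le.2 (hb _ _ hne (Nat.pos_of_ne_zero hpos)))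
    · rw [abs_sub_comm] at ha
      exact absurd ha (not_le.2 (hb _ _ hne.symm (Nat.pos_of_ne_zero hpos)))
  by_contra hcon
  have hfreq : ∃ᶠ n in atTop, n₀ ≤ n ∧ x₁ n ≠ x₂ n :=
    ((not_eventually.1 hcon).and_eventually (eventually_ge_atTop n₀)).mono fun n h => ⟨h.2, h.1⟩
  have hinf := Nat.frequently_atTop_iff_infinite.1 hfreq
  obtain ⟨i, hi, j, hj, hij, he⟩ := hinf.exists_ne_map_eq_of_mapsTo
    (f := fun n => Q n ω) (t := Set.univ) (fun _ _ => Set.mem_univ _) Set.finite_univ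
  have hlt (i j : ℕ) (hj : n₀ ≤ j ∧ x₁ j ≠ x₂ j) (hij : i < j) (he : Q i ω = Q j ω) : False := by
    have := visitsTo_pos Q ω hij
    rw [he, hbad j hj.1 hj.2] at this
    exact lt_irrefl _ this
  rcases lt_or_gt_of_ne hij with h | h
  · exact hlt i j hj h he
  · exact hlt j i hi h he.symm

lemma eventually_abs_outputs_le {E Ω : Type*} {D : Finset E} (f : E → ℝ) {q : ℕ → Ω → E}
    (ε : ℕ → Ω → ℝ) (ω : Ω) (hq : ∀ n, q n ω ∈ D)
    (hε : ∀ᶠ n : ℕ in atTop, |ε n ω| ≤ Real.log n) :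
    ∃ C : ℝ, 0 ≤ C ∧ ∀ᶠ n : ℕ in atTop, ∀ i, |outputs f q ε ω n i| ≤ C * Real.log n := by
  obtain ⟨n₀, hn₀⟩ := eventually_atTop.1 hε
  set F := ∑ x ∈ D, |f x|
  set G := ∑ i ∈ Finset.range n₀, |ε i ω|
  have hF : 0 ≤ F := Finset.sum_nonneg fun _ _ => abs_nonneg _
  have hG : 0 ≤ G := Finset.sum_nonneg fun _ _ => abs_nonneg _
  refine ⟨F + G + 1, by positivity, ?_⟩
  filter_upwards [eventually_le_log 1, eventually_ge_atTop 1] with n h1 hn i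
  have hf : |f (q i ω)| ≤ F :=
    Finset.single_le_sum (f := fun x => |f x|) (fun _ _ => abs_nonneg _) (hq i)
  have he : |ε i ω| ≤ G + Real.log n := by
    by_cases hi : n₀ ≤ (i : ℕ)
    · have h2 := hn₀ i hi
      have h3 : Real.log (i : ℕ) ≤ Real.log n := by
        rcases Nat.eq_zero_or_pos (i : ℕ) with h0 | h0
        · rw [h0]; simp; linarith
        · exact Real.log_le_log (by exact_mod_cast h0) (by exact_mod_cast i.2.le)
      linarith
    · have : |ε i ω| ≤ G := Finset.single_le_sum (f := fun i => |ε i ω|)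
        (fun _ _ => abs_nonneg _) (Finset.mem_range.2 (not_le.1 hi))
      linarith
  have h3 : |outputs f q ε ω n i| ≤ |f (q i ω)| + |ε i ω| := abs_add_le _ _
  nlinarith

lemma one_le_of_hasSum_inv {p : ℕ → ℝ} (hp : ∀ n, 0 < p n)
    (hp1 : HasSum (fun n => (p n)⁻¹) 1) (n : ℕ) : 1 ≤ p n := by
  have h := le_hasSum hp1 n fun i _ => (inv_pos.2 (hp i)).le
  exact (inv_le_one₀ (hp n)).1 h

lemma beta_ge {E : Type*} {D : Finset E} (hD : D.Nonempty) {p : ℕ → ℝ} (hp : ∀ n, 1 ≤ p n)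
    {δ : ℝ} (hδ : 0 < δ) (n : ℕ) : 2 * Real.log (1 / δ) ≤ beta D p δ n := by
  have hc : (1 : ℝ) ≤ D.card := by exact_mod_cast hD.card_pos
  rw [beta]
  have h1 : 1 ≤ (D.card : ℝ) * p n := by nlinarith [hp n]
  have : 1 / δ ≤ D.card * p n / δ := by gcongr
  have := Real.log_le_log (by positivity) this
  linarith

lemma beta_eventually_le {E : Type*} {D : Finset E} (hD : D.Nonempty) {p : ℕ → ℝ}
    (hp : ∀ n, 1 ≤ p n) {δ : ℝ} (hδ : 0 < δ)
    (hplog : (fun n => Real.log (p n)) =O[atTop] fun n : ℕ => Real.log n) :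
    ∃ C : ℝ, 0 ≤ C ∧ ∀ᶠ n : ℕ in atTop, beta D p δ n ≤ C * Real.log n := by
  obtain ⟨c, hc0, hc⟩ := hplog.exists_nonneg
  have hD' : (D.card : ℝ) ≠ 0 := by exact_mod_cast hD.card_pos.ne'
  refine ⟨2 * (|Real.log (D.card / δ)| + c), by positivity, ?_⟩
  filter_upwards [hc.bound, eventually_le_log 1] with n h1 h2
  have hpn : p n ≠ 0 := by linarith [hp n]
  rw [Real.norm_eq_abs, Real.norm_of_nonneg (by linarith)] at h1
  have h3 := le_abs_self (Real.log (p n))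
  have h4 := le_abs_self (Real.log (D.card / δ))
  have h5 := abs_nonneg (Real.log (D.card / δ))
  rw [beta, mul_div_right_comm, Real.log_mul (by positivity) hpn]
  nlinarith

end Asymptotic

/-! ### Estimates along a fixed outcome. -/

section Pathwise

open Filter

variable {E κ Ω : Type*} [Fintype κ] [DecidableEq κ] {D : Finset E} [DecidableEq D]
  {k : E → E → ℝ} {φ : D → κ → ℝ} {lam : ℝ≥0} {f : E → ℝ} {q : ℕ → Ω → E} {Q : ℕ → Ω → D}
  {ε : ℕ → Ω → ℝ} {ω : Ω} {b : ℕ → ℝ}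

/-- Visited points whose difference to another point is hardly explained by the observations are not
nearly tied with it. -/
lemma eventually_gap_of_weightSq_lt (hφ : ∀ x y : D, k x y = φ x ⬝ᵥ φ y) (hlam : 0 < lam)
    (hQ : ∀ n ω, (Q n ω : E) = q n ω) {b₀ : ℝ} (hb₀ : 0 < b₀) (hb : ∀ n, b₀ ≤ b n)
    {C : ℝ} (hC : 0 ≤ C)
    (hy : ∀ᶠ n : ℕ in atTop, ∀ i, |outputs f q ε ω n i| ≤ C * Real.log n)
    (hsep : ∀ x x' : D, x ≠ x' → φ x ≠ φ x') :
    ∀ᶠ n : ℕ in atTop, ∀ x x' : D, x ≠ x' → 0 < visitsTo Q ω n x →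
      weightSq φ lam (visitsTo Q ω n) (φ x - φ x') < (n : ℝ) ^ (-(3 / 2) : ℝ) →
      Real.log n ^ 2 / (n : ℝ) ^ 2 <
        |ucb k lam (inputs q ω n) (outputs f q ε ω n) (b n) x -
          ucb k lam (inputs q ω n) (outputs f q ε ω n) (b n) x'| := by
  obtain rfl : (fun n ω => (Q n ω : E)) = q := by ext n ω; exact hQ n ω
  refine eventually_all.2 fun x => eventually_all.2 fun x' => ?_
  by_cases hne : x = x'
  · exact Eventually.of_forall fun n h => absurd hne h
  set A := (φ x - φ x') ⬝ᵥ (φ x - φ x') with hAdef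
  have hA : 0 < A := (real_dotProduct_self_nonneg _).lt_of_ne fun h =>
    sub_ne_zero.2 (hsep x x' hne) (dotProduct_self_eq_zero.1 h.symm)
  set M := ∑ z, (φ z ⬝ᵥ (φ x - φ x')) ^ 2
  have hM0 : 0 ≤ M := Finset.sum_nonneg fun _ _ => sq_nonneg _
  have hM (z : D) : (φ z ⬝ᵥ (φ x - φ x')) ^ 2 ≤ M :=
    Finset.single_le_sum (f := fun z => (φ z ⬝ᵥ (φ x - φ x')) ^ 2) (fun _ _ => sq_nonneg _)
      (Finset.mem_univ z)
  have hkk (z : D) : 0 ≤ k z z := by rw [hφ]; exact real_dotProduct_self_nonneg _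
  set K := 1 + ∑ z : D, k z z
  have hK0 : 0 < K := by
    have : 0 ≤ ∑ z : D, k z z := Finset.sum_nonneg fun z _ => hkk z
    positivity
  have hK (z : D) : k z z ≤ K := by
    have := Finset.single_le_sum (f := fun z : D => k z z) (fun z _ => hkk z) (Finset.mem_univ z)
    simp only [K]
    linarith
  set g := √b₀ * (A / (8 * √K)) with hg
  have hg0 : 0 < g := by positivity
  -- Exponents for S < n^(-3/2): S n gives -1/2, √S gives -3/4, and √S √n log n gives -3/4 + 1/2 +
  -- 1/8 = -1/8 after bounding log n by n^(1/8).
  have t1 : ∀ᶠ n : ℕ in atTop, M * (n : ℝ) ^ (-(1 / 2) : ℝ) < A ^ 2 / 4 := by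
    have := (tendsto_nat_rpow_neg (s := 1 / 2) (by norm_num)).const_mul M
    rw [mul_zero] at this
    exact this.eventually_lt_const (by positivity)
  have t2 : ∀ᶠ n : ℕ in atTop, 2 * lam * (n : ℝ) ^ (-(3 / 4) : ℝ) < A / 4 := by
    have := (tendsto_nat_rpow_neg (s := 3 / 4) (by norm_num)).const_mul (2 * (lam : ℝ))
    rw [mul_zero] at this
    exact this.eventually_lt_const (by positivity)
  have t3 : ∀ᶠ n : ℕ in atTop, C * (n : ℝ) ^ (-(1 / 8) : ℝ) < g / 2 := by
    have := (tendsto_nat_rpow_neg (s := 1 / 8) (by norm_num)).const_mul C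
    rw [mul_zero] at this
    exact this.eventually_lt_const (by positivity)
  have t4 : ∀ᶠ n : ℕ in atTop, (n : ℝ) ^ (-(1 : ℝ)) < g / 2 :=
    (tendsto_nat_rpow_neg one_pos).eventually_lt_const (by positivity)
  filter_upwards [t1, t2, t3, t4, hy, eventually_log_pow_le 1 (s := 1 / 8) (by norm_num) one_pos,
    eventually_log_pow_le 2 (s := 1) (by norm_num) one_pos, eventually_ge_atTop 1]
    with n h1 h2 h3 h4 h5 h6 h7 hn1 _ hvis hS
  have hn : (0 : ℝ) < n := by exact_mod_cast hn1
  have hlog : 0 ≤ Real.log n := Real.log_nonneg (by exact_mod_cast hn1)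
  have hS0 := weightSq_nonneg φ (lam := lam) (visitsTo Q ω n) (φ x - φ x')
  have hSs : √(weightSq φ lam (visitsTo Q ω n) (φ x - φ x')) ≤ (n : ℝ) ^ (-(3 / 4) : ℝ) := by
    refine (Real.sqrt_le_sqrt hS.le).trans_eq ?_
    rw [Real.sqrt_eq_rpow, ← Real.rpow_mul hn.le]
    norm_num
  have hgap := ucb_gap hφ hlam (fun i : Fin n => Q i ω) (x := x) (x' := x') hvis hA le_rfl hM
    hK0 hK ?_ ?_ (Y := C * Real.log n) (by positivity) h5 (b n)
  · refine lt_of_lt_of_le ?_ hgap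
    have e1 : g ≤ √(b n) * (A / (8 * √K)) :=
      mul_le_mul_of_nonneg_right (Real.sqrt_le_sqrt (hb n)) (by positivity)
    have e2 : √(weightSq φ lam (visitsTo Q ω n) (φ x - φ x')) * (√n * (C * Real.log n)) ≤
        C * (n : ℝ) ^ (-(1 / 8) : ℝ) := by
      rw [pow_one, one_mul] at h6
      calc √(weightSq φ lam (visitsTo Q ω n) (φ x - φ x')) * (√n * (C * Real.log n))
          ≤ (n : ℝ) ^ (-(3 / 4) : ℝ) * ((n : ℝ) ^ (1 / 2 : ℝ) * (C * (n : ℝ) ^ (1 / 8 : ℝ))) := by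
            rw [Real.sqrt_eq_rpow (n : ℝ)]; gcongr
        _ = C * ((n : ℝ) ^ (-(3 / 4) : ℝ) * (n : ℝ) ^ (1 / 2 : ℝ) * (n : ℝ) ^ (1 / 8 : ℝ)) := by
            ring
        _ = C * (n : ℝ) ^ (-(1 / 8) : ℝ) := by
            rw [← Real.rpow_add hn, ← Real.rpow_add hn]; norm_num
    have e3 : Real.log n ^ 2 / (n : ℝ) ^ 2 ≤ (n : ℝ) ^ (-(1 : ℝ)) := by
      rw [Real.rpow_neg_one, div_le_iff₀ (by positivity)]
      rw [one_mul, Real.rpow_one] at h7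
      refine h7.trans_eq ?_
      field_simp
    change _ < √(b n) * (A / (8 * √K)) -
      √(weightSq φ lam (visitsTo Q ω n) (φ x - φ x')) * (√n * (C * Real.log n))
    linarith
  · change weightSq φ lam (visitsTo Q ω n) (φ x - φ x') * (n * M) < _
    refine lt_of_le_of_lt ?_ h1
    calc weightSq φ lam (visitsTo Q ω n) (φ x - φ x') * (n * M)
        ≤ (n : ℝ) ^ (-(3 / 2) : ℝ) * (n * M) := by gcongr
      _ = M * ((n : ℝ) ^ (-(3 / 2) : ℝ) * (n : ℝ) ^ (1 : ℝ)) := by rw [Real.rpow_one]; ring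
      _ = M * (n : ℝ) ^ (-(1 / 2) : ℝ) := by rw [← Real.rpow_add hn]; norm_num
  · change 2 * (lam : ℝ) * √(weightSq φ lam (visitsTo Q ω n) (φ x - φ x')) ≤ _
    refine le_trans ?_ h2.le
    gcongr

/-- On the event that the confidence bounds hold, the preference-augmented quantities differ from
the standard ones by `O(log n / n²)`. -/
lemma eventually_augmented_close (hφ : ∀ x y : D, k x y = φ x ⬝ᵥ φ y) (hlam : 0 < lam)
    (hQ : ∀ n ω, (Q n ω : E) = q n ω) {gam : ℝ} (hgam : 0 < gam)
    {m : ℕ → E → ℝ} (v : ℕ → E → ℝ≥0) {B : ℝ} (hm : ∀ n, ∀ x ∈ D, |m n x| ≤ B)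
    {C C' : ℝ} (hC : 0 ≤ C)
    (hy : ∀ᶠ n : ℕ in atTop, ∀ i, |outputs f q ε ω n i| ≤ C * Real.log n)
    (hC' : 0 ≤ C') (hb : ∀ᶠ n : ℕ in atTop, b n ≤ C' * Real.log n)
    (hconf : ∀ n, ∀ x ∈ D, |f x - postMean k lam (inputs q ω n) (outputs f q ε ω n) x| ≤
      √(b n) * √(postVar k lam (inputs q ω n) x)) :
    ∃ A : ℝ, 0 ≤ A ∧ ∀ᶠ n : ℕ in atTop, ∀ x : D,
      |augVar k lam (inputs q ω n) (outputs f q ε ω n) gam (v n) x -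
        postVar k lam (inputs q ω n) x| ≤ A * (Real.log n / (n : ℝ) ^ 2) ∧
      |augMean k lam (inputs q ω n) (outputs f q ε ω n) gam (m n) (v n) x -
        postMean k lam (inputs q ω n) (outputs f q ε ω n) x| ≤ A * (Real.log n / (n : ℝ) ^ 2) ∧
      |augUcb k lam (inputs q ω n) (outputs f q ε ω n) gam (m n) (v n) (b n) x -
        ucb k lam (inputs q ω n) (outputs f q ε ω n) (b n) x| ≤
          A * (Real.log n / (n : ℝ) ^ 2) := by
  obtain rfl : (fun n ω => (Q n ω : E)) = q := by ext n ω; exact hQ n ω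
  have hkk (z : D) : 0 ≤ k z z := by rw [hφ]; exact real_dotProduct_self_nonneg _
  set K := 1 + ∑ z : D, k z z with hKdef
  have hK1 : 1 ≤ K := le_add_of_nonneg_right (Finset.sum_nonneg fun z _ => hkk z)
  have hK (z : D) : k z z ≤ K := by
    have := Finset.single_le_sum (f := fun z : D => k z z) (fun z _ => hkk z) (Finset.mem_univ z)
    linarith
  set F := ∑ x ∈ D, |f x|
  have hF0 : 0 ≤ F := Finset.sum_nonneg fun _ _ => abs_nonneg _
  have hT : ∀ᶠ n : ℕ in atTop, 1 ≤ gam * (n : ℝ) ^ 2 := by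
    have : Tendsto (fun n : ℕ => gam * (n : ℝ) ^ 2) atTop atTop :=
      ((tendsto_pow_atTop (by norm_num)).comp tendsto_natCast_atTop_atTop).const_mul_atTop hgam
    exact this.eventually_ge_atTop 1
  set A₁ := C * (|B| + 2) + F + (C' + 1) * K with hA₁
  have hA₁0 : 0 ≤ A₁ := by positivity
  refine ⟨(A₁ + (C' + 1) * K + K) / gam, by positivity, ?_⟩
  filter_upwards [hT, hy, hb, eventually_le_log 1, eventually_ge_atTop 1]
    with n hT1 hyn hbn hl hn1 x
  have hn : (0 : ℝ) < n := by exact_mod_cast hn1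
  have hT0 : 0 < gam * (n : ℝ) ^ 2 := by positivity
  have hs0 : 0 ≤ postVar k lam (inputs (fun n ω => (Q n ω : E)) ω n) x :=
    postVar_nonneg hφ hlam (fun i : Fin n => Q i ω) x
  have hsK : postVar k lam (inputs (fun n ω => (Q n ω : E)) ω n) x ≤ K :=
    (postVar_le hφ hlam (fun i : Fin n => Q i ω) x).trans (hK x)
  have hz : postVar k lam (inputs (fun n ω => (Q n ω : E)) ω n) x = 0 →
      postMean k lam (inputs (fun n ω => (Q n ω : E)) ω n)
        (outputs f (fun n ω => (Q n ω : E)) ε ω n) x = 0 :=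
    postMean_eq_zero_of_postVar hφ hlam (fun i : Fin n => Q i ω) _ x
  have hc := hconf n x x.2
  set X := inputs (fun n ω => (Q n ω : E)) ω n
  set y := outputs f (fun n ω => (Q n ω : E)) ε ω n
  set l := Real.log n
  have hsq : √(postVar k lam X x) ≤ K :=
    (Real.sqrt_le_sqrt hsK).trans (Real.sqrt_le_iff.2 ⟨by linarith, by nlinarith⟩)
  -- Replacing C' by C' + 1 makes the right side at least 1, so it is below its own square.
  have hbq : √(b n) ≤ (C' + 1) * l := by
    refine Real.sqrt_le_iff.2 ⟨by positivity, hbn.trans ?_⟩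
    have h1 : C' * l ≤ (C' + 1) * l := by nlinarith
    have h2 : 1 ≤ (C' + 1) * l := by nlinarith
    nlinarith
  have hprod : √(b n) * √(postVar k lam X x) ≤ (C' + 1) * K * l := by
    calc √(b n) * √(postVar k lam X x) ≤ ((C' + 1) * l) * K := by gcongr
      _ = (C' + 1) * K * l := by ring
  have hfx : |f x| ≤ F :=
    Finset.single_le_sum (f := fun x => |f x|) (fun _ _ => abs_nonneg _) x.2
  have hμ : |postMean k lam X y x| ≤ F + (C' + 1) * K * l := by
    have := abs_sub_abs_le_abs_sub (postMean k lam X y x) (f x)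
    rw [abs_sub_comm] at this
    linarith
  have hν : |prefMean y (m n) x| ≤ C * l * (|B| + 2) :=
    abs_prefMean_le (by positivity) hyn ((hm n x x.2).trans (le_abs_self B))
  have hA : |prefMean y (m n) x| + |postMean k lam X y x| ≤ A₁ * l := by
    rw [hA₁]
    nlinarith
  have hmean := (abs_augMean_sub_le (v := v n) hs0 hT0 hz).trans
    (div_le_div_of_nonneg_right hA hT0.le)
  have hvar := (abs_augVar_sub_le (y := y) (v := v n) hs0 hT0).trans
    (div_le_div_of_nonneg_right (hsK.trans (le_mul_of_one_le_right (by linarith) hl)) hT0.le)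
  have hsqrt := abs_sqrt_augVar_sub_le (y := y) (v := v n) hs0 hT1
  have hsd : |√(b n) * (√(augVar k lam X y gam (v n) x) - √(postVar k lam X x))| ≤
      (C' + 1) * K * l / (gam * (n : ℝ) ^ 2) := by
    rw [abs_mul, abs_of_nonneg (Real.sqrt_nonneg _)]
    refine (mul_le_mul_of_nonneg_left hsqrt (Real.sqrt_nonneg _)).trans ?_
    rw [← mul_div_assoc]
    exact div_le_div_of_nonneg_right hprod hT0.le
  have hu : |augUcb k lam X y gam (m n) (v n) (b n) x - ucb k lam X y (b n) x| ≤
      A₁ * l / (gam * (n : ℝ) ^ 2) + (C' + 1) * K * l / (gam * (n : ℝ) ^ 2) := by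
    rw [augUcb, ucb, show ∀ a b c d e : ℝ, a + c * d - (b + c * e) = (a - b) + c * (d - e) by
      intros; ring]
    exact (abs_add_le _ _).trans (add_le_add hmean hsd)
  have e : (A₁ + (C' + 1) * K + K) / gam * (l / (n : ℝ) ^ 2) =
      A₁ * l / (gam * (n : ℝ) ^ 2) + (C' + 1) * K * l / (gam * (n : ℝ) ^ 2) +
        K * l / (gam * (n : ℝ) ^ 2) := by
    field_simp
  have p1 : 0 ≤ A₁ * l / (gam * (n : ℝ) ^ 2) := by positivity
  have p2 : 0 ≤ (C' + 1) * K * l / (gam * (n : ℝ) ^ 2) := by positivity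
  have p3 : 0 ≤ K * l / (gam * (n : ℝ) ^ 2) := by positivity
  rw [e]
  exact ⟨by linarith, by linarith, by linarith⟩

end Pathwise

/-! ### Information gain and cumulative regret. -/

section Regret

open Filter

/-- Repeat w in all T rounds: the Gram matrix has rank at most one and the determinant is explicit.
A bound independent of T is enough here. -/
lemma maxInfoGain_ge {E : Type*} {k : E → E → ℝ} {lam : ℝ≥0} {D : Finset E} {w : E} (hw : w ∈ D)
    (hk : 0 ≤ k w w) {T : ℕ} (hT : 1 ≤ T) :
    1 / 2 * Real.log (1 + (lam : ℝ)⁻¹ * k w w) ≤ maxInfoGain k lam D T := by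
  have e : (1 + ((lam : ℝ)⁻¹) • gram k (fun _ : Fin T => w) : Matrix (Fin T) (Fin T) ℝ) =
      1 + Matrix.replicateCol Unit (fun _ : Fin T => (lam : ℝ)⁻¹ * k w w) *
        Matrix.replicateRow Unit (fun _ : Fin T => (1 : ℝ)) := by
    ext i j
    simp [gram, Matrix.mul_apply]
  have hdet : (1 + ((lam : ℝ)⁻¹) • gram k (fun _ : Fin T => w) : Matrix (Fin T) (Fin T) ℝ).det =
      1 + T * ((lam : ℝ)⁻¹ * k w w) := by
    rw [e, Matrix.det_one_add_replicateCol_mul_replicateRow]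
    simp [dotProduct]
  have h := le_ciSup (f := fun X : Fin T → D => (1 / 2) * Real.log
    (1 + ((lam : ℝ)⁻¹) • gram k (fun i => (X i : E)) : Matrix (Fin T) (Fin T) ℝ).det)
    (Set.finite_range _).bddAbove (fun _ => ⟨w, hw⟩)
  refine le_trans ?_ h
  simp only [hdet]
  have h0 : 0 ≤ (lam : ℝ)⁻¹ * k w w := mul_nonneg (inv_nonneg.2 lam.2) hk
  have h1 : (1 : ℝ) ≤ T := by exact_mod_cast hT
  refine mul_le_mul_of_nonneg_left (Real.log_le_log (by positivity) ?_) (by norm_num)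
  nlinarith

lemma log_sq_isBigO {G : ℕ → ℝ} {c : ℝ} (hc : 0 < c) (hG : ∀ T, 1 ≤ T → c ≤ G T) :
    (fun T : ℕ => Real.log T ^ 2) =O[atTop] fun T : ℕ => √(T * G T * Real.log T) := by
  refine Asymptotics.IsBigO.of_bound (1 / √c) ?_
  filter_upwards [eventually_log_pow_le 4 (s := 1) one_pos one_pos, eventually_le_log 1,
    eventually_ge_atTop 1] with T h1 h2 h3
  rw [Real.norm_of_nonneg (by positivity), Real.norm_of_nonneg (Real.sqrt_nonneg _),
    div_mul_eq_mul_div, one_mul, le_div_iff₀ (Real.sqrt_pos.2 hc)]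
  refine Real.le_sqrt_of_sq_le ?_
  rw [one_mul, Real.rpow_one] at h1
  rw [mul_pow, Real.sq_sqrt hc.le, ← pow_mul]
  have hT : (0 : ℝ) ≤ T := Nat.cast_nonneg T
  calc Real.log T ^ (2 * 2) * c ≤ T * G T := by
        have := hG T h3
        exact mul_le_mul h1 this hc.le hT
    _ ≤ T * G T * Real.log T :=
        le_mul_of_one_le_right (mul_nonneg hT (hc.le.trans (hG T h3))) h2

variable {E κ Ω : Type*} [Fintype κ] [DecidableEq κ] {D : Finset E} [DecidableEq D]
  {k : E → E → ℝ} {φ : D → κ → ℝ} {lam : ℝ≥0} {f : E → ℝ} {q : ℕ → Ω → E} {Q : ℕ → Ω → D}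
  {ε : ℕ → Ω → ℝ} {ω : Ω} {b : ℕ → ℝ}

/-- A suboptimal point whose upper confidence bound is nearly maximal has been visited at most
`O(log n)` times. -/
lemma visits_eventually_le_of_ucb_ge (hφ : ∀ x y : D, k x y = φ x ⬝ᵥ φ y) (hlam : 0 < lam)
    (hQ : ∀ n ω, (Q n ω : E) = q n ω) {C : ℝ}
    (hb0 : ∀ n, 0 ≤ b n) (hb : ∀ᶠ n : ℕ in atTop, b n ≤ C * Real.log n)
    (hconf : ∀ n, ∀ x ∈ D, |f x - postMean k lam (inputs q ω n) (outputs f q ε ω n) x| ≤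
      √(b n) * √(postVar k lam (inputs q ω n) x))
    {z xs : D} (hz : f z < f xs) {W : ℕ → ℝ} (hW : Tendsto W atTop (nhds 0))
    (hu : ∀ᶠ n : ℕ in atTop, Q n ω = z → ucb k lam (inputs q ω n) (outputs f q ε ω n) (b n) xs ≤
      ucb k lam (inputs q ω n) (outputs f q ε ω n) (b n) z + W n) :
    ∀ᶠ n : ℕ in atTop, Q n ω = z →
      (visitsTo Q ω n z : ℝ) ≤ 16 * lam * C / (f xs - f z) ^ 2 * Real.log n := by
  obtain rfl : (fun n ω => (Q n ω : E)) = q := by ext n ω; exact hQ n ω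
  have hΔ : 0 < f xs - f z := sub_pos.2 hz
  filter_upwards [hu, hb, hW.eventually_le_const (half_pos hΔ)] with n h1 h2 h3 hq
  have h4 := h1 hq
  have c1 := (abs_le.1 (hconf n xs xs.2)).2
  have c2 := (abs_le.1 (hconf n z z.2)).1
  have hvis : (visitsTo Q ω n z : ℝ) *
      postVar k lam (inputs (fun n ω => (Q n ω : E)) ω n) z ≤ lam :=
    visits_mul_postVar_le hφ hlam (fun i : Fin n => Q i ω) z
  have hs0 : 0 ≤ postVar k lam (inputs (fun n ω => (Q n ω : E)) ω n) z :=
    postVar_nonneg hφ hlam (fun i : Fin n => Q i ω) z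
  rw [ucb, ucb] at h4
  set s := postVar k lam (inputs (fun n ω => (Q n ω : E)) ω n) z
  set N : ℝ := ((visitsTo Q ω n z : ℕ) : ℝ)
  have hN0 : 0 ≤ N := Nat.cast_nonneg _
  -- The chain is f xs ≤ ucb xs ≤ ucb z + W ≤ f z + 2 √b √s + W, with W at most half the gap.
  have h5 : (f xs - f z) / 4 ≤ √(b n) * √s := by linarith
  have h6 : (f xs - f z) ^ 2 / 16 ≤ b n * s := by
    have := pow_le_pow_left₀ (by positivity) h5 2
    rw [mul_pow, Real.sq_sqrt (hb0 n), Real.sq_sqrt hs0] at this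
    nlinarith
  rw [div_mul_eq_mul_div, le_div_iff₀ (by positivity)]
  have h7 : N * (b n * s) ≤ lam * b n := by
    have := mul_le_mul_of_nonneg_left hvis (hb0 n)
    linarith
  have h8 := mul_le_mul_of_nonneg_left h6 hN0
  have h9 := mul_le_mul_of_nonneg_left h2 lam.2
  nlinarith

/-- Group the rounds by queried point: the maximiser costs nothing and every other point is visited
at most (log T)² times. -/
lemma sum_regret_isBigO (hQ : ∀ n ω, (Q n ω : E) = q n ω) {xs : D}
    (hmax : ∀ z : D, f z ≤ f xs)
    (hvis : ∀ z : D, z ≠ xs →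
      ∀ᶠ n : ℕ in atTop, (visitsTo Q ω n z : ℝ) ≤ Real.log n ^ 2) :
    (fun T : ℕ => ∑ n ∈ Finset.range T, (f xs - f (q n ω))) =O[atTop]
      fun T : ℕ => Real.log T ^ 2 := by
  have e (T : ℕ) : ∑ n ∈ Finset.range T, (f xs - f (q n ω)) =
      ∑ z, (visitsTo Q ω T z : ℝ) * (f xs - f z) := by
    rw [visitsTo, sum_visits_mul, Finset.sum_range]
    simp only [hQ]
  simp only [e]
  refine Asymptotics.IsBigO.fun_sum fun z _ => ?_
  by_cases hz : z = xs
  · subst hz; simp only [sub_self, mul_zero]; exact Asymptotics.isBigO_zero _ _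
  · refine Asymptotics.IsBigO.of_bound (f xs - f z) ?_
    filter_upwards [hvis z hz] with T hT
    rw [norm_mul, Real.norm_of_nonneg (Nat.cast_nonneg _),
      Real.norm_of_nonneg (sub_nonneg.2 (hmax z)), Real.norm_of_nonneg (by positivity), mul_comm]
    exact mul_le_mul_of_nonneg_left hT (sub_nonneg.2 (hmax z))

lemma sum_isBigO_of_eventuallyEq {u v g : ℕ → ℝ} (h : ∀ᶠ n in atTop, u n = v n)
    (hv : (fun T : ℕ => ∑ n ∈ Finset.range T, v n) =O[atTop] g)
    (h1 : (fun _ : ℕ => (1 : ℝ)) =O[atTop] g) :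
    (fun T : ℕ => ∑ n ∈ Finset.range T, u n) =O[atTop] g := by
  obtain ⟨n₀, hn₀⟩ := eventually_atTop.1 h
  have hd : (fun T : ℕ => ∑ n ∈ Finset.range T, (u n - v n)) =O[atTop] fun _ => (1 : ℝ) := by
    refine Asymptotics.IsBigO.of_bound |∑ n ∈ Finset.range n₀, (u n - v n)| ?_
    filter_upwards [eventually_ge_atTop n₀] with T hT
    rw [← Finset.sum_range_add_sum_Ico _ hT, Finset.sum_eq_zero (s := Finset.Ico n₀ T)
      fun n hn => sub_eq_zero.2 (hn₀ n (Finset.mem_Ico.1 hn).1)]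
    simp
  refine (hv.add (hd.trans h1)).congr_left fun T => ?_
  rw [← Finset.sum_add_distrib]
  exact Finset.sum_congr rfl fun _ _ => by ring

lemma exists_features {E : Type*} {D : Finset E} {k : E → E → ℝ}
    (hk : (Matrix.of fun x y : D => k x y).PosSemidef) :
    ∃ (r : ℕ) (φ : D → Fin r → ℝ), ∀ x y : D, k x y = φ x ⬝ᵥ φ y := by
  obtain ⟨r, w, hw⟩ := Matrix.posSemidef_iff_eq_sum_vecMulVec.1 hk
  refine ⟨r, fun x i => w i x, fun x y => ?_⟩
  have := congrFun (congrFun hw x) y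
  simpa [Matrix.sum_apply, Matrix.vecMulVec_apply, dotProduct] using this

end Regret

end CoExBO

end


/-! ### The no harm guarantee. -/

theorem lemma2 {d : ℕ} {Ω : Type*} {mΩ : MeasurableSpace Ω}
    (P : MeasureTheory.Measure Ω) [MeasureTheory.IsProbabilityMeasure P]
    -- decision set, objective function and its maximiser
    (D : Finset (EuclideanSpace ℝ (Fin d))) (f : EuclideanSpace ℝ (Fin d) → ℝ)
    (xs : EuclideanSpace ℝ (Fin d)) (hxs : xs ∈ D) (hmax : ∀ x ∈ D, x ≠ xs → f x < f xs)
    -- positive semidefinite kernel that separates the points of the decision set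
    (k : EuclideanSpace ℝ (Fin d) → EuclideanSpace ℝ (Fin d) → ℝ)
    (hk : (Matrix.of fun x y : D => k x y).PosSemidef)
    (hsep : ∀ x ∈ D, ∀ y ∈ D, x ≠ y → 0 < k x x + k y y - 2 * k x y)
    -- parameters
    (lam : ℝ≥0) (hlam : 0 < lam) (gam : ℝ) (hgam : 0 < gam)
    (δ : ℝ) (hδ : δ ∈ Set.Ioo (0 : ℝ) 1)
    (p : ℕ → ℝ) (hp : ∀ n, 0 < p n) (hp1 : HasSum (fun n => (p n)⁻¹) 1)
    (hplog : (fun n => Real.log (p n)) =O[Filter.atTop] fun n : ℕ => Real.log n)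
    -- i.i.d. Gaussian noise, independent of what is known when the query is chosen
    (ℱ : MeasureTheory.Filtration ℕ mΩ) (ε : ℕ → Ω → ℝ)
    (hεm : ∀ n, Measurable[ℱ (n + 1)] (ε n))
    (hεlaw : ∀ n, P.map (ε n) = ProbabilityTheory.gaussianReal 0 lam)
    (hεind : ∀ n, ProbabilityTheory.Indep
      (MeasurableSpace.comap (ε n) inferInstance) (ℱ n) P)
    -- user belief: an arbitrary sequence of Gaussian fields with bounded means
    (m : ℕ → Ω → EuclideanSpace ℝ (Fin d) → ℝ)
    (v : ℕ → Ω → EuclideanSpace ℝ (Fin d) → ℝ≥0)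
    (hm : ∀ ω, ∃ B : ℝ, ∀ n, ∀ x ∈ D, |m n ω x| ≤ B)
    -- the queries `q`, and the candidates `x₁`, `x₂` among which the user chooses them
    (q x₁ x₂ : ℕ → Ω → EuclideanSpace ℝ (Fin d))
    (hqm : ∀ n, Measurable[ℱ n] (q n))
    (hx₁D : ∀ n ω, x₁ n ω ∈ D)
    (hx₁ : ∀ n ω, IsMaxOn (CoExBO.ucb k lam (CoExBO.inputs q ω n) (CoExBO.outputs f q ε ω n)
      (CoExBO.beta D p δ n)) D (x₁ n ω))
    (hx₂D : ∀ n ω, x₂ n ω ∈ D)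
    (hx₂ : ∀ n ω, IsMaxOn (CoExBO.augUcb k lam (CoExBO.inputs q ω n)
      (CoExBO.outputs f q ε ω n) gam (m n ω) (v n ω) (CoExBO.beta D p δ n)) D (x₂ n ω))
    (hq : ∀ n ω, q n ω = x₁ n ω ∨ q n ω = x₂ n ω) :
    ∀ᵐ ω ∂P,
      -- on the event that the confidence bounds hold
      (∀ n, ∀ x ∈ D,
        |f x - CoExBO.postMean k lam (CoExBO.inputs q ω n) (CoExBO.outputs f q ε ω n) x| ≤
          √(CoExBO.beta D p δ n) * √(CoExBO.postVar k lam (CoExBO.inputs q ω n) x)) →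
      -- posterior variance, posterior mean and acquisition function
      (∀ x ∈ D, Filter.Tendsto (fun n =>
        CoExBO.augVar k lam (CoExBO.inputs q ω n) (CoExBO.outputs f q ε ω n) gam (v n ω) x -
          CoExBO.postVar k lam (CoExBO.inputs q ω n) x) Filter.atTop (nhds 0)) ∧
      (∀ x ∈ D, Filter.Tendsto (fun n =>
        CoExBO.augMean k lam (CoExBO.inputs q ω n) (CoExBO.outputs f q ε ω n) gam
            (m n ω) (v n ω) x -
          CoExBO.postMean k lam (CoExBO.inputs q ω n) (CoExBO.outputs f q ε ω n) x)
        Filter.atTop (nhds 0)) ∧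
      (∀ x ∈ D, Filter.Tendsto (fun n =>
        CoExBO.augUcb k lam (CoExBO.inputs q ω n) (CoExBO.outputs f q ε ω n) gam
            (m n ω) (v n ω) (CoExBO.beta D p δ n) x -
          CoExBO.ucb k lam (CoExBO.inputs q ω n) (CoExBO.outputs f q ε ω n)
            (CoExBO.beta D p δ n) x) Filter.atTop (nhds 0)) ∧
      -- candidates
      Filter.Tendsto (fun n => dist (x₂ n ω) (x₁ n ω)) Filter.atTop (nhds 0) ∧
      -- instantaneous regrets: asymptotically equal, and the ratio, where defined, tends to 1
      Asymptotics.IsEquivalent Filter.atTop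
        (fun n => f xs - f (x₂ n ω)) (fun n => f xs - f (x₁ n ω)) ∧
      Filter.Tendsto (fun n => (f xs - f (x₂ n ω)) / (f xs - f (x₁ n ω)))
        (Filter.atTop ⊓ Filter.principal {n | f xs - f (x₁ n ω) ≠ 0}) (nhds 1) ∧
      -- cumulative regrets of the augmented acquisition function and of the queries
      ((fun T : ℕ => ∑ n ∈ Finset.range T, (f xs - f (x₂ n ω))) =O[Filter.atTop]
        fun T : ℕ => √(T * CoExBO.maxInfoGain k lam D T * Real.log T)) ∧
      ((fun T : ℕ => ∑ n ∈ Finset.range T, (f xs - f (q n ω))) =O[Filter.atTop]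
        fun T : ℕ => √(T * CoExBO.maxInfoGain k lam D T * Real.log T)) := by
  classical
  obtain ⟨r, φ, hφ⟩ := CoExBO.exists_features hk
  have hDne : D.Nonempty := ⟨xs, hxs⟩
  have hp' := CoExBO.one_le_of_hasSum_inv hp hp1
  have hδ0 := hδ.1
  have hb₀ : 0 < 2 * Real.log (1 / δ) :=
    mul_pos two_pos (Real.log_pos ((one_lt_div hδ0).2 hδ.2))
  have hb := fun n => CoExBO.beta_ge hDne hp' hδ0 n
  have hb0 : ∀ n, 0 ≤ CoExBO.beta D p δ n := fun n => hb₀.le.trans (hb n)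
  obtain ⟨Cb, hCb, hbC⟩ := CoExBO.beta_eventually_le hDne hp' hδ0 hplog
  have hqD : ∀ n ω, q n ω ∈ D := fun n ω => by
    rcases hq n ω with h | h <;> rw [h]
    exacts [hx₁D n ω, hx₂D n ω]
  let Q : ℕ → Ω → D := fun n ω => ⟨q n ω, hqD n ω⟩
  have hQq : ∀ n ω, (Q n ω : EuclideanSpace ℝ (Fin d)) = q n ω := fun _ _ => rfl
  have hQm : ∀ n, Measurable[ℱ n] (Q n) := fun n => (hqm n).subtype_mk
  have hsepφ : ∀ x x' : D, x ≠ x' → φ x ≠ φ x' := fun x x' hne he => by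
    have := hsep x x.2 x' x'.2 fun h => hne (Subtype.ext h)
    rw [hφ, hφ, hφ, he] at this
    linarith
  have hε : ∀ n, Measurable (ε n) := fun n => (hεm n).mono (ℱ.le _) le_rfl
  filter_upwards [CoExBO.eventually_abs_noise_le_log hε hεlaw,
    CoExBO.eventually_not_near_tie hεm hεlaw hεind hQm hlam (⟨xs, hxs⟩ : D)
      (fun (x : D × D) N z => φ z ⬝ᵥ CoExBO.infoSolve φ lam N (φ x.1 - φ x.2))
      (fun x N n => CoExBO.gapCenter φ lam f (CoExBO.beta D p δ n) x.1 x.2 N)]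
    with ω hnoise hties hconf
  obtain ⟨Cy, hCy, hy⟩ := CoExBO.eventually_abs_outputs_le f (q := q) ε ω (fun n => hqD n ω) hnoise
  obtain ⟨B, hB⟩ := hm ω
  obtain ⟨A, hA0, hA⟩ := CoExBO.eventually_augmented_close hφ hlam hQq hgam (v := fun n => v n ω) hB
    hCy hy hCb hbC hconf
  have hA' : Filter.Tendsto (fun n : ℕ => A * (Real.log n / (n : ℝ) ^ 2)) Filter.atTop (nhds 0) := by
    simpa using CoExBO.tendsto_log_div_sq.const_mul A
  have hW : Filter.Tendsto (fun n : ℕ => 2 * (A * (Real.log n / (n : ℝ) ^ 2)))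
      Filter.atTop (nhds 0) := by
    simpa using hA'.const_mul 2
  have hcand : ∀ᶠ n : ℕ in Filter.atTop,
      CoExBO.ucb k lam (CoExBO.inputs q ω n) (CoExBO.outputs f q ε ω n)
        (CoExBO.beta D p δ n) (x₁ n ω) ≤
      CoExBO.ucb k lam (CoExBO.inputs q ω n) (CoExBO.outputs f q ε ω n)
        (CoExBO.beta D p δ n) (x₂ n ω) + 2 * (A * (Real.log n / (n : ℝ) ^ 2)) := by
    -- Pass from `ucb` to `augUcb` at x₁, use maximality of x₂, and pass back at x₂; each passage
    -- costs one error term.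
    filter_upwards [hA] with n hn
    have a1 := (abs_le.1 (hn ⟨x₁ n ω, hx₁D n ω⟩).2.2).1
    have a2 := (abs_le.1 (hn ⟨x₂ n ω, hx₂D n ω⟩).2.2).2
    have a3 := hx₂ n ω (hx₁D n ω)
    simp only [Set.mem_ofPred_eq] at a3
    linarith
  have hvis : ∀ z : D, z ≠ ⟨xs, hxs⟩ → ∀ᶠ n : ℕ in Filter.atTop,
      (CoExBO.visitsTo Q ω n z : ℝ) ≤ Real.log n ^ 2 := fun z hz => by
    have hlt : f z < f xs := hmax z z.2 fun h => hz (Subtype.ext h)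
    refine CoExBO.visitsTo_eventually_le_log_sq Q ω z _ (by positivity)
      (CoExBO.visits_eventually_le_of_ucb_ge hφ hlam hQq hb0 hbC hconf
        (xs := ⟨xs, hxs⟩) hlt hW ?_)
    filter_upwards [hcand] with n hn hqz
    have hz' : q n ω = z := congrArg Subtype.val hqz
    have a1 : CoExBO.ucb k lam (CoExBO.inputs q ω n) (CoExBO.outputs f q ε ω n)
        (CoExBO.beta D p δ n) xs ≤ CoExBO.ucb k lam (CoExBO.inputs q ω n)
        (CoExBO.outputs f q ε ω n) (CoExBO.beta D p δ n) (x₁ n ω) := hx₁ n ω hxs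
    have a2 : CoExBO.ucb k lam (CoExBO.inputs q ω n) (CoExBO.outputs f q ε ω n)
        (CoExBO.beta D p δ n) (x₂ n ω) ≤ CoExBO.ucb k lam (CoExBO.inputs q ω n)
        (CoExBO.outputs f q ε ω n) (CoExBO.beta D p δ n) (x₁ n ω) := hx₁ n ω (hx₂D n ω)
    rcases hq n ω with h | h <;> rw [← hz', h] <;> linarith
  have htie₁ : ∀ᶠ n : ℕ in Filter.atTop,
      |CoExBO.ucb k lam (CoExBO.inputs q ω n) (CoExBO.outputs f q ε ω n)
        (CoExBO.beta D p δ n) (x₁ n ω) -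
      CoExBO.ucb k lam (CoExBO.inputs q ω n) (CoExBO.outputs f q ε ω n)
        (CoExBO.beta D p δ n) (x₂ n ω)| ≤ Real.log n ^ 2 / (n : ℝ) ^ 2 := by
    -- The second logarithm in the window absorbs the outcome-dependent constant 2 A, so the window
    -- in the almost sure statement is deterministic.
    filter_upwards [hcand, CoExBO.eventually_le_log (2 * A), CoExBO.eventually_le_log 1]
      with n hn hl hl1
    have a2 : CoExBO.ucb k lam (CoExBO.inputs q ω n) (CoExBO.outputs f q ε ω n)
        (CoExBO.beta D p δ n) (x₂ n ω) ≤ CoExBO.ucb k lam (CoExBO.inputs q ω n)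
        (CoExBO.outputs f q ε ω n) (CoExBO.beta D p δ n) (x₁ n ω) := hx₁ n ω (hx₂D n ω)
    rw [abs_of_nonneg (sub_nonneg.2 a2)]
    have : 2 * (A * (Real.log n / (n : ℝ) ^ 2)) ≤ Real.log n ^ 2 / (n : ℝ) ^ 2 := by
      rw [← mul_div_assoc, ← mul_div_assoc]
      refine div_le_div_of_nonneg_right ?_ (by positivity)
      nlinarith
    linarith
  have htie₂ : ∀ᶠ n : ℕ in Filter.atTop, ∀ x x' : D, x ≠ x' → 0 < CoExBO.visitsTo Q ω n x →
      Real.log n ^ 2 / (n : ℝ) ^ 2 <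
        |CoExBO.ucb k lam (CoExBO.inputs q ω n) (CoExBO.outputs f q ε ω n)
          (CoExBO.beta D p δ n) x -
        CoExBO.ucb k lam (CoExBO.inputs q ω n) (CoExBO.outputs f q ε ω n)
          (CoExBO.beta D p δ n) x'| := by
    have hbox : ∀ᶠ n : ℕ in Filter.atTop, ∀ z : D, z ≠ ⟨xs, hxs⟩ →
        (CoExBO.visitsTo Q ω n z : ℝ) ≤ Real.log n ^ 2 :=
      Filter.eventually_all.2 fun z => by
        by_cases hz : z = ⟨xs, hxs⟩
        · exact Filter.Eventually.of_forall fun n h => absurd hz h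
        · exact (hvis z hz).mono fun n h _ => h
    filter_upwards [CoExBO.eventually_gap_of_weightSq_lt hφ hlam hQq hb₀ hb hCy hy hsepφ, hties,
      hbox] with n h1 h2 h3 x x' hne hpos
    -- Dichotomy: little information gives a deterministic gap, otherwise the noise breaks the tie.
    rcases lt_or_ge (CoExBO.weightSq φ lam (CoExBO.visitsTo Q ω n) (φ x - φ x'))
      ((n : ℝ) ^ (-(3 / 2) : ℝ)) with h | h
    · exact h1 x x' hne hpos h
    · have h4 := h2 (x, x') h3 h
      rwa [← CoExBO.ucb_sub_eq hφ hlam f Q ε ω n (CoExBO.beta D p δ n) x x'] at h4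
  have heq' : ∀ᶠ n in Filter.atTop, (⟨x₁ n ω, hx₁D n ω⟩ : D) = ⟨x₂ n ω, hx₂D n ω⟩ :=
    CoExBO.eventually_eq_of_ties Q ω (fun n => ⟨x₁ n ω, hx₁D n ω⟩) (fun n => ⟨x₂ n ω, hx₂D n ω⟩)
      (fun n (x : D) => CoExBO.ucb k lam (CoExBO.inputs q ω n) (CoExBO.outputs f q ε ω n)
        (CoExBO.beta D p δ n) x) _ htie₁ htie₂
      fun n => (hq n ω).imp (fun h => Subtype.ext h) fun h => Subtype.ext h
  have heq : ∀ᶠ n in Filter.atTop, x₁ n ω = x₂ n ω :=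
    heq'.mono fun n h => congrArg Subtype.val h
  have hqeq : ∀ᶠ n in Filter.atTop, x₂ n ω = q n ω := by
    filter_upwards [heq] with n hn
    rcases hq n ω with h | h
    · rw [h, hn]
    · exact h.symm
  refine ⟨fun x hx => ?_, fun x hx => ?_, fun x hx => ?_, ?_, ?_, ?_, ?_⟩
  · exact squeeze_zero_norm' (hA.mono fun n h => (h ⟨x, hx⟩).1) hA'
  · exact squeeze_zero_norm' (hA.mono fun n h => (h ⟨x, hx⟩).2.1) hA'
  · exact squeeze_zero_norm' (hA.mono fun n h => (h ⟨x, hx⟩).2.2) hA'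
  · exact tendsto_const_nhds.congr' (heq.mono fun n h => by simp [h])
  · exact (show (fun n => f xs - f (x₂ n ω)) =ᶠ[Filter.atTop] fun n => f xs - f (x₁ n ω) from
      heq.mono fun n h => by simp only [h]).isEquivalent
  · refine tendsto_const_nhds.congr' ?_
    rw [Filter.EventuallyEq, Filter.eventually_inf_principal]
    filter_upwards [heq] with n h hne
    rw [← h, div_self hne]
  -- If D is a single point the kernel, and with it the information gain, may vanish, but so does
  -- the regret. Otherwise separation rules out that all features are zero.
  · by_cases hex : ∃ z ∈ D, z ≠ xs
    · have hgain : ∃ c : ℝ, 0 < c ∧ ∀ T, 1 ≤ T → c ≤ CoExBO.maxInfoGain k lam D T := by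
        obtain ⟨z, hz, hne⟩ := hex
        have hnn : ∀ x : D, 0 ≤ k x x := fun x => by
          rw [hφ]; exact CoExBO.real_dotProduct_self_nonneg _
        obtain ⟨w, hw, hkw⟩ : ∃ w ∈ D, 0 < k w w := by
          by_contra! hcon
          have hzero : ∀ x : D, φ x = 0 := fun x => by
            have h1 := le_antisymm (hcon x x.2) (hnn x)
            rw [hφ] at h1
            exact dotProduct_self_eq_zero.1 h1
          exact hsepφ ⟨z, hz⟩ ⟨xs, hxs⟩ (fun h => hne (congrArg Subtype.val h))
            ((hzero _).trans (hzero _).symm)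
        refine ⟨1 / 2 * Real.log (1 + (lam : ℝ)⁻¹ * k w w), ?_,
          fun T hT => CoExBO.maxInfoGain_ge hw hkw.le hT⟩
        have hl : (0 : ℝ) < lam := hlam
        have : 0 < (lam : ℝ)⁻¹ * k w w := by positivity
        exact mul_pos (by norm_num) (Real.log_pos (by linarith))
      obtain ⟨c, hc, hG⟩ := hgain
      have hsq := CoExBO.log_sq_isBigO hc hG
      have hone : (fun _ : ℕ => (1 : ℝ)) =O[Filter.atTop] fun T : ℕ => Real.log T ^ 2 := by
        refine Asymptotics.IsBigO.of_bound 1 ?_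
        filter_upwards [CoExBO.eventually_le_log 1] with T hT
        rw [norm_one, one_mul, Real.norm_of_nonneg (by positivity)]
        exact one_le_pow₀ hT
      have hreg := (CoExBO.sum_regret_isBigO hQq (xs := ⟨xs, hxs⟩) (fun z => by
        by_cases h : (z : EuclideanSpace ℝ (Fin d)) = xs
        · rw [h]
        · exact (hmax z z.2 h).le) hvis).trans hsq
      exact ⟨CoExBO.sum_isBigO_of_eventuallyEq (hqeq.mono fun n h => by rw [h]) hreg
        (hone.trans hsq), hreg⟩
    · push Not at hex
      have e1 : ∀ n, f xs - f (x₂ n ω) = 0 := fun n => by rw [hex _ (hx₂D n ω), sub_self]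
      have e2 : ∀ n, f xs - f (q n ω) = 0 := fun n => by rw [hex _ (hqD n ω), sub_self]
      simp only [e1, e2, Finset.sum_const_zero]
      exact ⟨Asymptotics.isBigO_zero _ _, Asymptotics.isBigO_zero _ _⟩
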